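/- Let $L\ge 3$ and consider the cubic lattice with vertex set $(\mathbb Z/L)^3$ (periodic boundary conditions), with one qubit on every link. For a cube $c$ let $A_c$ be the product of Pauli $X$ over the $12$ links of $c$; for a vertex $v$ and a direction $k\in\{x,y,z\}$ let $B_v^k$ be the product of Pauli $Z$ over the $4$ links at $v$ perpendicular to $k$. The X-cube Hamiltonian is $H=-\sum_c A_c-\sum_{v,k}B_v^k$. As nonlocal stabilizers take all $\prod_{l\in \mathbf D}Z_l$, where $\mathbf D$ is a straight noncontractible dual loop: for directions $d\ne k$ and a vertex $v$, the $L$ parallel links in direction $d$ that start at the vertices $v+i\hat k$, $i\in\mathbb Z/L$. A *dual string* is a nonempty set $A$ of links that can be listed as $l_1,\dots,l_n$ without repetition so that consecutive links lie on a common elementary cube, and which does not intersect itself in the following sense: no plaquette contains more than two links of $A$, two links of $A$ on a common plaquette are consecutive, and the links of $A$ on any given cube are consecutive in the list. It is *closed* ($\partial A=\emptyset$, a dual loop) if it has such a listing with $n\ge 3$ in cyclic order (so that $l_n,l_1$ count as consecutive), and $A$ is *planar* if all its links lie in a single lattice plane. For a state $|\psi\rangle$ put $S_A=-\mathrm{Tr}\,\rho_A\log_2\rho_A$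 with $\rho_A$ the reduced density matrix on the qubits in $A$, and $\zeta(A)=S_A-|A|$. Then: 1. There is, up to a phase, exactly one normalized state $|\psi\rangle$ that is a $+1$ eigenvector of all $A_c$, all $B_v^k$ and all nonlocal stabilizers. 2. For this state and every dual string $A$ which is planar or contains no complete straight lattice line (the $L$ collinear links along a lattice direction), $$\zeta(A)=\begin{cases}-1,& A\text{ is closed and lies in a single lattice plane},\\ 0,&\text{otherwise.}\end{cases}$$ 3. Every product of operators $B_v^k$ is supported on an even number of links (possibly zero) of every straight lattice line. 4. If $A$ is a closed dual string (contractible or not) that is not planar, then no product of operators $B_v^k$ other than the identity is supported on a subset of $A$. -/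

import Mathlib

namespace XCube

open Finset

/-! ### The periodic cubic lattice -/

/-- Vertices of the `L × L × L` cubic lattice with periodic boundary conditions. -/
abbrev Vertex (L : ℕ) := Fin 3 → ZMod L

/-- Links of the lattice: `(w, d)` is the link from the vertex `w` to the vertex `w + e_d`.
Every link carries one qubit. -/
abbrev Link (L : ℕ) := Vertex L × Fin 3

variable {L : ℕ} [NeZero L]

/-- The twelve links of the elementary cube `v + [0,1]³`. -/
def cube (v : Vertex L) : Finset (Link L) :=
  univ.filter fun l => l.1 l.2 = v l.2 ∧ ∀ j, j ≠ l.2 → (l.1 j = v j ∨ l.1 j = v j + 1)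

/-- The four links of the elementary plaquette that is perpendicular to direction `k` and has
`v` as its lowest corner: the face of the cube at `v` that lies in the plane `x_k = v_k`. -/
def plaquette (v : Vertex L) (k : Fin 3) : Finset (Link L) :=
  (cube v).filter fun l => l.2 ≠ k ∧ l.1 k = v k

/-- The four links that end at the vertex `v` and are perpendicular to direction `k`. -/
def vertexStar (v : Vertex L) (k : Fin 3) : Finset (Link L) :=
  univ.filter fun l => l.2 ≠ k ∧ (l.1 = v ∨ l.1 + Pi.single l.2 1 = v)

/-- The lattice plane `x_k = h`, as the set of links lying in it. -/
def plane (k : Fin 3) (h : ZMod L) : Finset (Link L) :=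
  univ.filter fun l => l.2 ≠ k ∧ l.1 k = h

/-- The straight line in direction `d` through the vertex `v`: `L` collinear links. -/
def line (v : Vertex L) (d : Fin 3) : Finset (Link L) :=
  univ.filter fun l => l.2 = d ∧ ∀ j, j ≠ d → l.1 j = v j

/-- For `d ≠ k`, the straight noncontractible dual loop along direction `k` which consists of the
`L` parallel links `(v + i e_k, d)`. -/
def dualLoop (v : Vertex L) (k d : Fin 3) : Finset (Link L) :=
  univ.filter fun l => l.2 = d ∧ ∀ j, j ≠ k → l.1 j = v j

/-! ### The stabilizer state -/

variable (L) in
/-- Configurations of the qubits in the `Z` basis. -/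
abbrev Config := Link L → ZMod 2

variable (L) in
/-- Vectors of the Hilbert space `⨂_l ℂ²`, by their coefficients in the `Z` basis. -/
abbrev State := Config L → ℂ

/-- `∏_{l ∈ S} X_l`: flips all qubits in `S`. -/
def pauliX (S : Finset (Link L)) (ψ : State L) : State L :=
  fun s => ψ (fun l => if l ∈ S then s l + 1 else s l)

/-- `∏_{l ∈ S} Z_l`, where `Z` is the diagonal matrix with entries `1, -1`. -/
def pauliZ (S : Finset (Link L)) (ψ : State L) : State L :=
  fun s => (∏ l ∈ S, if s l = 0 then 1 else -1) * ψ s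

/-- A normalized state which is a `+1` eigenvector of all the local stabilizers `A_c` (products of
`X` over a cube) and `B_v^k` (products of `Z` over a star) of the X-cube Hamiltonian
`-∑_c A_c - ∑_{v,k} B_v^k`, and of all the nonlocal stabilizers `∏ Z_l` over straight
noncontractible dual loops. -/
structure IsXCubeState (ψ : State L) : Prop where
  normalized : ∑ s, ‖ψ s‖ ^ 2 = 1
  cube_stab : ∀ v, pauliX (cube v) ψ = ψ
  star_stab : ∀ v k, pauliZ (vertexStar v k) ψ = ψ
  loop_stab : ∀ v k d, d ≠ k → pauliZ (dualLoop v k d) ψ = ψ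

/-! ### Entanglement entropy -/

/-- The configuration which is `a` on `A` and `b` outside `A`. -/
def glue (A : Finset (Link L)) (a : {l // l ∈ A} → ZMod 2) (b : {l // l ∉ A} → ZMod 2) :
    Config L :=
  fun l => if h : l ∈ A then a ⟨l, h⟩ else b ⟨l, h⟩

/-- The reduced density matrix `ρ_A = Tr_{Aᶜ} |ψ⟩⟨ψ|`. -/
noncomputable def reducedDensity (ψ : State L) (A : Finset (Link L)) :
    Matrix ({l // l ∈ A} → ZMod 2) ({l // l ∈ A} → ZMod 2) ℂ :=
  fun a a' => ∑ b : {l // l ∉ A} → ZMod 2, ψ (glue A a b) * star (ψ (glue A a' b))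

theorem reducedDensity_isHermitian (ψ : State L) (A : Finset (Link L)) :
    (reducedDensity ψ A).IsHermitian := by
  ext a a'
  simp [reducedDensity, Matrix.conjTranspose_apply, mul_comm]

/-- The von Neumann entropy `S_A = -Tr ρ_A log₂ ρ_A`, through the eigenvalues of `ρ_A`. -/
noncomputable def entropy (ψ : State L) (A : Finset (Link L)) : ℝ :=
  ∑ i, Real.negMulLog ((reducedDensity_isHermitian ψ A).eigenvalues i) / Real.log 2

/-- The subleading term `ζ(A)` in `S_A = |A| + ζ(A)`. -/
noncomputable def zeta (ψ : State L) (A : Finset (Link L)) : ℝ :=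
  entropy ψ A - (#A : ℝ)

/-! ### Dual strings -/

/-- `ℓ` is a string of `n` links in the dual lattice, whose order is given by the graph `H` on
`Fin n` (a path for open strings, a cycle for closed ones). Consecutive links lie on a common cube
(a site of the dual lattice), and the string does not intersect itself: it repeats no link, it does
not return to a plaquette or to a cube. -/
structure IsDualCurve {n : ℕ} (H : SimpleGraph (Fin n)) (ℓ : Fin n → Link L) : Prop where
  injective : Function.Injective ℓ
  consecutive : ∀ i j, H.Adj i j → ∃ v, ℓ i ∈ cube v ∧ ℓ j ∈ cube v
  plaquette_adj : ∀ v k i j, i ≠ j → ℓ i ∈ plaquette v k → ℓ j ∈ plaquette v k → H.Adj i j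
  plaquette_card : ∀ v k, #(univ.filter fun i => ℓ i ∈ plaquette v k) ≤ 2
  cube_connected : ∀ v, (H.induce {i | ℓ i ∈ cube v}).Preconnected

/-- `A` is the set of links of an open dual string. -/
def IsOpenDualString (A : Finset (Link L)) : Prop :=
  ∃ (n : ℕ) (ℓ : Fin n → Link L), 1 ≤ n ∧ IsDualCurve (SimpleGraph.pathGraph n) ℓ ∧
    univ.image ℓ = A

/-- `A` is the set of links of a closed dual string, i.e. of a dual loop. -/
def IsClosedDualString (A : Finset (Link L)) : Prop :=
  ∃ (n : ℕ) (ℓ : Fin n → Link L), 3 ≤ n ∧ IsDualCurve (SimpleGraph.cycleGraph n) ℓ ∧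
    univ.image ℓ = A

/-- `A` is the set of links of a dual string. -/
def IsDualString (A : Finset (Link L)) : Prop :=
  IsOpenDualString A ∨ IsClosedDualString A

/-- `A` lies in a single lattice plane. -/
def IsPlanar (A : Finset (Link L)) : Prop := ∃ k h, A ⊆ plane k h

/-- The support of `∏_{(v,k) ∈ F} B_v^k`: as `Z² = 1`, these are the links which lie in an odd number
of the stars. -/
def supportB (F : Finset (Vertex L × Fin 3)) : Finset (Link L) :=
  univ.filter fun l => Odd #(F.filter fun p => l ∈ vertexStar p.1 p.2)

end XCube

namespace XCube

open Finset

set_option linter.unusedSectionVars false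

variable {L : ℕ} [NeZero L]

/-! ### The code generated by the cubes -/

/-! Let C be the binary code spanned by the indicators of the cubes. By `mem_cubeCode_iff`, C
consists exactly of the configurations of even parity on every star and every straight dual loop.
The `Z` stabilizers therefore confine the support of a stabilizer state to C, and the cube
stabilizers make it constant on C. The state is the uniform superposition over C, unique up to
phase.

If no nonzero element of C is supported on A, then ρ_A is diagonal and uniform on the restriction of
C to A (`entropy_eq`). By duality (`mem_map_restrict`) this restriction is the orthogonal complement
of W, the space of configurations supported on A that are even on every cube. Hence ζ(A) = -dim W,
and two facts about dual strings remain.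

No nonzero codeword lives on A. If A is planar, a dual loop normal to the plane meets A in at most
one link. If A contains no full line, a nonzero codeword that is constant along lines cannot fit,
and one that is not constant makes three links of A meet at a corner; these form a triangle, so they
are all of A, and a nearby star is violated (`eq_zero_of_no_line`).

W is nonzero only for a planar loop. No cube contains exactly one link of the support of an element
of W. The four cubes around such a link must then be covered by its at most two neighbours, which
forces the neighbours to lie opposite each other in one plane (`coplanar_of_cover`). This propagates
along the string (`eq_univ_and_planar`), so W is at most {0, 1_A}; conversely 1_A is even on cubes
for a planar loop (`sum_cube_ind`). Supports of products of `B_v^k` are even on cubes, so the same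
rigidity excludes them from nonplanar loops. -/

/-- The indicator function of a set of links. -/
def ind (S : Finset (Link L)) : Config L := fun l => if l ∈ S then 1 else 0

theorem sum_ind (S T : Finset (Link L)) : ∑ l ∈ S, ind T l = (#(S ∩ T) : ZMod 2) := by
  simp [ind, Finset.sum_ite_mem]

theorem sum_ind_comm (S T : Finset (Link L)) : ∑ l ∈ S, ind T l = ∑ l ∈ T, ind S l := by
  rw [sum_ind, sum_ind, inter_comm]

theorem zmod_two_ne_zero {x : ZMod 2} : x ≠ 0 ↔ x = 1 := by
  revert x; decide

/-- The backward difference in direction `d`, modulo 2. -/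
def diff (d : Fin 3) : (Vertex L → ZMod 2) →ₗ[ZMod 2] (Vertex L → ZMod 2) :=
  LinearMap.id + LinearMap.funLeft (ZMod 2) (ZMod 2) fun v => v - Pi.single d 1

theorem diff_apply (d : Fin 3) (g : Vertex L → ZMod 2) (v : Vertex L) :
    diff d g v = g v + g (v - Pi.single d 1) := rfl

theorem diff_comm (d e : Fin 3) (g : Vertex L → ZMod 2) :
    diff d (diff e g) = diff e (diff d g) := by
  ext v
  simp only [diff_apply, sub_right_comm v (Pi.single d 1)]
  ring

/-- The product of the cubes `v` with `g v = 1`. -/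
def cubeMap : (Vertex L → ZMod 2) →ₗ[ZMod 2] Config L where
  toFun g l := diff (l.2 + 1) (diff (l.2 + 2) g) l.1
  map_add' g h := by ext; simp
  map_smul' c g := by ext; simp

theorem cubeMap_apply (g : Vertex L → ZMod 2) (v : Vertex L) (d : Fin 3) :
    cubeMap g (v, d) = diff (d + 1) (diff (d + 2) g) v := rfl

theorem cubeMap_single (hL : 3 ≤ L) (u : Vertex L) :
    cubeMap (Pi.single u 1) = ind (cube u) := by
  have : Fact (1 < L) := ⟨by omega⟩
  have h1 : (1 : ZMod L) ≠ 0 := one_ne_zero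
  ext ⟨w, d⟩
  have trichotomy : ∀ m, (w m = u m ∧ w m ≠ u m + 1) ∨ (w m ≠ u m ∧ w m = u m + 1) ∨
      (w m ≠ u m ∧ w m ≠ u m + 1) := by
    intro m
    by_cases h : w m = u m
    · simp [h]
    · simp [h, em]
  fin_cases d <;>
  · simp only [cubeMap_apply, diff_apply, ind, cube, Pi.single_apply, funext_iff,
      Fin.forall_fin_succ, mem_filter, mem_univ]
    simp only [Fin.isValue, Fin.zero_eta, Fin.mk_one, Fin.reduceFinMk, zero_add, Fin.reduceAdd,
      Pi.sub_apply, Pi.single_apply, sub_eq_iff_eq_add, Fin.succ_zero_eq_one, Fin.succ_one_eq_two,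
      Fin.reduceEq, if_true, if_false, add_zero, true_and, ne_eq, not_true_eq_false,
      not_false_eq_true, forall_const, IsEmpty.forall_iff, and_true]
    rcases trichotomy 0 with ⟨a, a'⟩ | ⟨a, a'⟩ | ⟨a, a'⟩ <;>
    rcases trichotomy 1 with ⟨b, b'⟩ | ⟨b, b'⟩ | ⟨b, b'⟩ <;>
    rcases trichotomy 2 with ⟨c, c'⟩ | ⟨c, c'⟩ | ⟨c, c'⟩ <;>
    simp [a, a', b, b', c, c']

/-- The group of products of cubes. -/
def cubeCode (L : ℕ) [NeZero L] : Submodule (ZMod 2) (Config L) := LinearMap.range cubeMap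

theorem ind_cube_mem (hL : 3 ≤ L) (u : Vertex L) : ind (cube u) ∈ cubeCode L :=
  ⟨_, cubeMap_single hL u⟩

theorem cubeMap_eq_sum (hL : 3 ≤ L) (g : Vertex L → ZMod 2) :
    cubeMap g = ∑ u, g u • ind (cube u) := by
  conv_lhs => rw [← Finset.univ_sum_single g]
  rw [map_sum]
  refine Finset.sum_congr rfl fun u _ => ?_
  rw [← cubeMap_single hL, ← map_smul]
  congr 1
  ext v
  simp [Pi.single_apply]

/-! ### Characterization of the code by the stars and the straight dual loops -/

/-- The two links at `v` in direction `d` contribute the difference of `s` in that direction.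
Vanishing of all stars thus says that this difference does not depend on the direction. -/
theorem sum_vertexStar (hL : 3 ≤ L) (s : Config L) (v : Vertex L) (k : Fin 3) :
    ∑ l ∈ vertexStar v k, s l = ∑ d ∈ univ.erase k, diff d (fun w => s (w, d)) v := by
  have : Fact (1 < L) := ⟨by omega⟩
  rw [vertexStar, Finset.sum_filter, Fintype.sum_prod_type_right,
    ← Finset.sum_subset (Finset.subset_univ (univ.erase k))]
  · refine Finset.sum_congr rfl fun d hd => ?_
    have hd' : d ≠ k := by simpa using hd
    have hne : v ≠ v - Pi.single d 1 := by
      intro h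
      have h' : v d - 1 = v d := by simpa using (congrFun h d).symm
      exact one_ne_zero (sub_eq_self.1 h')
    rw [diff_apply, ← Finset.sum_pair (f := fun w => s (w, d)) hne, ← Finset.sum_filter]
    refine Finset.sum_congr ?_ fun _ _ => rfl
    ext w
    simp [hd', eq_sub_iff_add_eq]
  · intro d _ hd
    have hd' : d = k := by simpa using hd
    simp [hd']

theorem sum_dualLoop (s : Config L) (v : Vertex L) (k d : Fin 3) :
    ∑ l ∈ dualLoop v k d, s l = ∑ t : ZMod L, s (Function.update v k t, d) := by
  symm
  refine Finset.sum_bij (fun t _ => (Function.update v k t, d)) ?_ ?_ ?_ fun _ _ => rfl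
  · intro t _
    simp only [dualLoop, mem_filter, mem_univ, true_and]
    intro j hj
    simp [hj]
  · intro t _ t' _ h
    simpa using congrFun (congrArg Prod.fst h) k
  · rintro ⟨w, e⟩ h
    simp only [dualLoop, mem_filter, mem_univ, true_and] at h
    refine ⟨w k, mem_univ _, ?_⟩
    rw [Prod.mk.injEq]
    refine ⟨?_, h.1.symm⟩
    ext j
    by_cases hj : j = k
    · subst hj; simp
    · simp [hj, h.2 j hj]

theorem update_sub_single (v : Vertex L) (k : Fin 3) (t : ZMod L) :
    Function.update v k t - Pi.single k 1 = Function.update v k (t - 1) := by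
  ext j
  by_cases hj : j = k
  · subst hj; simp
  · simp [hj]

theorem sum_diff (g : Vertex L → ZMod 2) (v : Vertex L) (k : Fin 3) :
    ∑ t : ZMod L, diff k g (Function.update v k t) = 0 := by
  simp only [diff_apply, update_sub_single, Finset.sum_add_distrib]
  have h := Equiv.sum_comp (Equiv.subRight (1 : ZMod L)) fun t => g (Function.update v k t)
  simp only [Equiv.subRight_apply] at h
  rw [h]
  exact CharTwo.add_self_eq_zero _

theorem cubeMap_apply' (g : Vertex L → ZMod 2) (v : Vertex L) {d j k : Fin 3} (hdj : d ≠ j)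
    (hdk : d ≠ k) (hjk : j ≠ k) : cubeMap g (v, d) = diff j (diff k g) v := by
  have : (j = d + 1 ∧ k = d + 2) ∨ (j = d + 2 ∧ k = d + 1) := by
    revert d j k; decide
  rcases this with ⟨rfl, rfl⟩ | ⟨rfl, rfl⟩
  · rfl
  · rw [diff_comm]; rfl

theorem exists_third (j k : Fin 3) : ∃ d, d ≠ j ∧ d ≠ k := by
  revert j k; decide

theorem exists_others (d : Fin 3) : ∃ j k, d ≠ j ∧ d ≠ k ∧ j ≠ k ∧ ∀ m, m = d ∨ m = j ∨ m = k := by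
  revert d; decide

theorem sum_dualLoop_cubeMap (g : Vertex L → ZMod 2) (v : Vertex L) {k d : Fin 3} (h : d ≠ k) :
    ∑ l ∈ dualLoop v k d, cubeMap g l = 0 := by
  obtain ⟨j, hjd, hjk⟩ := exists_third d k
  rw [sum_dualLoop]
  simp only [cubeMap_apply' g _ h hjd.symm hjk.symm, sum_diff]

theorem diff_cubeMap (g : Vertex L → ZMod 2) (d : Fin 3) :
    diff d (fun w => cubeMap g (w, d)) = diff 0 (diff 1 (diff 2 g)) := by
  change diff d (diff (d + 1) (diff (d + 2) g)) = _
  fin_cases d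
  · rfl
  · change diff 1 (diff 2 (diff 0 g)) = _
    rw [diff_comm 2 0, diff_comm 1 0]
  · change diff 2 (diff 0 (diff 1 g)) = _
    rw [diff_comm 2 0, diff_comm 2 1]

theorem sum_vertexStar_cubeMap (hL : 3 ≤ L) (g : Vertex L → ZMod 2) (v : Vertex L) (k : Fin 3) :
    ∑ l ∈ vertexStar v k, cubeMap g l = 0 := by
  rw [sum_vertexStar hL]
  simp only [diff_cubeMap, Finset.sum_const]
  rw [show #((univ : Finset (Fin 3)).erase k) = 2 by simp, two_nsmul]
  exact CharTwo.add_self_eq_zero _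

/-! ### Discrete integration and the converse inclusion for the code -/

/-- The partial sums of `f` in direction `k`. -/
def integral (k : Fin 3) (f : Vertex L → ZMod 2) (v : Vertex L) : ZMod 2 :=
  ∑ i ∈ range ((v k).val + 1), f (Function.update v k (i : ZMod L))

theorem sum_range_cast (f : ZMod L → ZMod 2) : ∑ i ∈ range L, f (i : ZMod L) = ∑ t, f t := by
  refine Finset.sum_bij (fun i _ => (i : ZMod L)) (fun _ _ => mem_univ _) ?_ ?_ fun _ _ => rfl
  · intro i hi j hj h
    have := congrArg ZMod.val h
    rwa [ZMod.val_cast_of_lt (mem_range.1 hi), ZMod.val_cast_of_lt (mem_range.1 hj)] at this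
  · intro t _
    exact ⟨t.val, mem_range.2 t.val_lt, by simp⟩

theorem diff_integral {k : Fin 3} {f : Vertex L → ZMod 2}
    (hf : ∀ v, ∑ t : ZMod L, f (Function.update v k t) = 0) : diff k (integral k f) = f := by
  ext v
  have hup : v - Pi.single k 1 = Function.update v k (v k - 1) := by
    simpa using update_sub_single v k (v k)
  rw [diff_apply, hup]
  simp only [integral, Function.update_idem, Function.update_self]
  have hlast : f (Function.update v k (((v k).val : ℕ) : ZMod L)) = f v := by simp
  rw [Finset.sum_range_succ, hlast]
  -- At coordinate 0 the preceding point is L - 1, whose partial sum runs over the whole loop; only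
  -- here is `hf` used.
  by_cases h0 : v k = 0
  · have hL : (v k - 1).val + 1 = L := by
      rw [h0, zero_sub]
      obtain ⟨n, rfl⟩ : ∃ n, L = n + 1 := ⟨L - 1, by have := NeZero.pos L; omega⟩
      rw [ZMod.val_neg_one]
    rw [hL, sum_range_cast fun t => f (Function.update v k t), hf]
    simp [h0]
  · have hval : (v k - 1).val + 1 = (v k).val := by
      have h1 : 1 ≤ (v k).val := Nat.one_le_iff_ne_zero.2 fun h => h0 ((ZMod.val_eq_zero _).1 h)
      have h2 : v k - 1 = (((v k).val - 1 : ℕ) : ZMod L) := by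
        rw [Nat.cast_sub h1]; simp
      rw [h2, ZMod.val_cast_of_lt (by have := (v k).val_lt; omega)]
      omega
    rw [hval]
    rw [add_right_comm, CharTwo.add_self_eq_zero, zero_add]

theorem integral_sum_eq_zero {j k : Fin 3} (hjk : j ≠ k) {f : Vertex L → ZMod 2}
    (hf : ∀ v, ∑ t : ZMod L, f (Function.update v j t) = 0) (v : Vertex L) :
    ∑ t : ZMod L, integral k f (Function.update v j t) = 0 := by
  simp only [integral, Function.update_of_ne hjk.symm]
  rw [Finset.sum_comm]
  refine Finset.sum_eq_zero fun i _ => ?_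
  simp only [Function.update_comm hjk]
  exact hf _

theorem diff_integral_eq_zero {j k : Fin 3} (hjk : j ≠ k) {f : Vertex L → ZMod 2}
    (hf : diff j f = 0) : diff j (integral k f) = 0 := by
  ext v
  have h : ∀ i : ZMod L, Function.update (v - Pi.single j 1) k i
      = Function.update v k i - Pi.single j 1 := by
    intro i
    ext m
    by_cases hm : m = k
    · subst hm; simp [hjk.symm]
    · simp [hm]
  simp only [diff_apply, integral, Pi.sub_apply, Pi.single_eq_of_ne hjk.symm, sub_zero, h,
    ← Finset.sum_add_distrib]
  exact Finset.sum_eq_zero fun i _ => congrFun hf _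

/-- Integration along one direction preserves zero loop sums and zero differences along the others,
so it can be done twice. The last clause keeps the potential constant in the third direction. -/
theorem exists_diff_diff_eq {j k : Fin 3} (hjk : j ≠ k) {f : Vertex L → ZMod 2}
    (hj : ∀ v, ∑ t : ZMod L, f (Function.update v j t) = 0)
    (hk : ∀ v, ∑ t : ZMod L, f (Function.update v k t) = 0) :
    ∃ g, diff j (diff k g) = f ∧ ∀ d, d ≠ j → d ≠ k → diff d f = 0 → diff d g = 0 := by
  refine ⟨integral k (integral j f), ?_, fun d hdj hdk hd =>
    diff_integral_eq_zero hdk (diff_integral_eq_zero hdj hd)⟩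
  rw [diff_integral (integral_sum_eq_zero hjk.symm hk), diff_integral hj]

theorem mem_cubeCode_of_diff (s : Config L)
    (hs : ∀ d e, diff d (fun w => s (w, d)) = diff e (fun w => s (w, e)))
    (hloop : ∀ v k d, d ≠ k → ∑ t : ZMod L, s (Function.update v k t, d) = 0) :
    s ∈ cubeCode L := by
  -- The `d` component of a configuration can be matched by cubes; if its `d` difference vanishes,
  -- these cubes leave the other two components untouched.
  have key : ∀ d j k : Fin 3, d ≠ j → d ≠ k → j ≠ k → ∀ s : Config L,
      (∀ v k d, d ≠ k → ∑ t : ZMod L, s (Function.update v k t, d) = 0) →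
      ∃ g, (∀ w, cubeMap g (w, d) = s (w, d)) ∧
        (diff d (fun w => s (w, d)) = 0 → ∀ w e, e ≠ d → cubeMap g (w, e) = 0) := by
    intro d j k hdj hdk hjk s hs
    obtain ⟨g, hg, hg'⟩ := exists_diff_diff_eq hjk (f := fun w => s (w, d))
      (fun v => hs v j d hdj) (fun v => hs v k d hdk)
    refine ⟨g, fun w => by rw [cubeMap_apply' g w hdj hdk hjk, hg], fun h w e he => ?_⟩
    obtain ⟨m, hm, hm'⟩ := exists_third d e
    rw [cubeMap_apply' g w hm'.symm he hm, hg' d hdj hdk h]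
    simp
  obtain ⟨g₀, h₀, -⟩ := key 0 1 2 (by decide) (by decide) (by decide) s hloop
  have hsub : ∀ d e, diff d (fun w => (s - cubeMap g₀) (w, d))
      = diff e (fun w => (s - cubeMap g₀) (w, e)) := by
    intro d e
    change diff d ((fun w => s (w, d)) - fun w => cubeMap g₀ (w, d))
      = diff e ((fun w => s (w, e)) - fun w => cubeMap g₀ (w, e))
    rw [map_sub, map_sub, hs d e, diff_cubeMap, diff_cubeMap]
  -- Once the component 0 is removed its difference is 0, hence by the star relations so are the
  -- other two. The components 1 and 2 can then be removed independently.
  have hzero : ∀ d, diff d (fun w => (s - cubeMap g₀) (w, d)) = 0 := by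
    intro d
    rw [hsub d 0]
    have : (fun w => (s - cubeMap g₀) (w, 0)) = 0 := by
      ext w; simp [h₀]
    rw [this, map_zero]
  have hloop' : ∀ v k d, d ≠ k →
      ∑ t : ZMod L, (s - cubeMap g₀) (Function.update v k t, d) = 0 := by
    intro v k d h
    simp only [Pi.sub_apply, Finset.sum_sub_distrib, hloop v k d h, ← sum_dualLoop,
      sum_dualLoop_cubeMap g₀ v h, sub_zero]
  obtain ⟨g₁, h₁, h₁'⟩ := key 1 0 2 (by decide) (by decide) (by decide) _ hloop'
  obtain ⟨g₂, h₂, h₂'⟩ := key 2 0 1 (by decide) (by decide) (by decide) _ hloop'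
  refine ⟨g₀ + g₁ + g₂, ?_⟩
  have e₁ := h₁' (hzero 1)
  have e₂ := h₂' (hzero 2)
  ext ⟨w, d⟩
  rw [map_add, map_add, Pi.add_apply, Pi.add_apply]
  fin_cases d
  · simp [e₁, e₂, h₀]
  · simp [e₂, h₁]
  · simp [e₁, h₂]

theorem diff_eq_of_sum_vertexStar (hL : 3 ≤ L) {s : Config L} {v : Vertex L}
    (hs : ∀ k, ∑ l ∈ vertexStar v k, s l = 0) (d e : Fin 3) :
    diff d (fun w => s (w, d)) v = diff e (fun w => s (w, e)) v := by
  by_cases hde : d = e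
  · subst hde; rfl
  · obtain ⟨k, hkd, hke⟩ := exists_third d e
    have h := hs k
    rw [sum_vertexStar hL,
      show univ.erase k = {d, e} by clear hs h; revert d e k; decide, Finset.sum_pair hde] at h
    exact CharTwo.add_eq_zero.1 h

theorem mem_cubeCode_iff (hL : 3 ≤ L) (s : Config L) :
    s ∈ cubeCode L ↔ (∀ v k, ∑ l ∈ vertexStar v k, s l = 0) ∧
      ∀ v k d, d ≠ k → ∑ l ∈ dualLoop v k d, s l = 0 := by
  constructor
  · rintro ⟨g, rfl⟩
    exact ⟨sum_vertexStar_cubeMap hL g, fun v k d h => sum_dualLoop_cubeMap g v h⟩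
  · rintro ⟨hstar, hloop⟩
    refine mem_cubeCode_of_diff s (fun d e => ?_) fun v k d h => ?_
    · ext v
      exact diff_eq_of_sum_vertexStar hL (hstar v) d e
    · rw [← sum_dualLoop, hloop v k d h]

/-! ### Parity of the supports of products of `B_v^k` -/

theorem even_card_inter_iff (S T : Finset (Link L)) :
    Even #(S ∩ T) ↔ ∑ l ∈ S, ind T l = 0 := by
  rw [sum_ind, ZMod.natCast_eq_zero_iff_even]

theorem ind_supportB (F : Finset (Vertex L × Fin 3)) :
    ind (supportB F) = ∑ p ∈ F, ind (vertexStar p.1 p.2) := by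
  ext l
  simp only [ind, supportB, mem_filter, mem_univ, true_and, Finset.sum_apply, Finset.sum_boole]
  split_ifs with h
  · exact ((ZMod.natCast_eq_one_iff_odd).2 h).symm
  · exact ((ZMod.natCast_eq_zero_iff_even).2 (Nat.not_odd_iff_even.1 h)).symm

theorem sum_ind_supportB (S : Finset (Link L)) (hS : ∀ v k, ∑ l ∈ vertexStar v k, ind S l = 0)
    (F : Finset (Vertex L × Fin 3)) : ∑ l ∈ S, ind (supportB F) l = 0 := by
  rw [ind_supportB]
  simp only [Finset.sum_apply]
  rw [Finset.sum_comm]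
  refine Finset.sum_eq_zero fun p _ => ?_
  rw [sum_ind_comm, hS]

theorem sum_cube_supportB (hL : 3 ≤ L) (F : Finset (Vertex L × Fin 3)) (u : Vertex L) :
    ∑ l ∈ cube u, ind (supportB F) l = 0 :=
  sum_ind_supportB _ (((mem_cubeCode_iff hL _).1 (ind_cube_mem hL u)).1) F

/-- A line is invariant under translation along itself, so its indicator has zero difference at
every vertex and is even on every star. -/
theorem sum_line_supportB (hL : 3 ≤ L) (F : Finset (Vertex L × Fin 3)) (v : Vertex L) (d : Fin 3) :
    ∑ l ∈ line v d, ind (supportB F) l = 0 := by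
  refine sum_ind_supportB _ (fun w k => ?_) F
  rw [sum_vertexStar hL]
  refine Finset.sum_eq_zero fun e _ => ?_
  rw [diff_apply]
  have : (w, e) ∈ line v d ↔ (w - Pi.single e 1, e) ∈ line v d := by
    simp only [line, mem_filter, mem_univ, true_and]
    refine and_congr_right fun h => forall_congr' fun j => imp_congr_right fun hj => ?_
    subst h
    simp [hj]
  simp only [ind, this]
  exact CharTwo.add_self_eq_zero _

/-! ### Uniqueness of the stabilizer state -/

theorem pauliX_apply (S : Finset (Link L)) (ψ : State L) (s : Config L) :
    pauliX S ψ s = ψ (s + ind S) := by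
  unfold pauliX
  congr 1
  ext l
  by_cases h : l ∈ S <;> simp [ind, h]

theorem pauliZ_apply (S : Finset (Link L)) (ψ : State L) (s : Config L) :
    pauliZ S ψ s = (if ∑ l ∈ S, s l = 0 then 1 else -1) * ψ s := by
  have h : ∏ l ∈ S, (if s l = 0 then (1 : ℂ) else -1) = if ∑ l ∈ S, s l = 0 then 1 else -1 := by
    classical
    induction S using Finset.induction_on with
    | empty => simp
    | insert a S ha ih =>
      rw [Finset.prod_insert ha, Finset.sum_insert ha, ih]
      generalize ∑ l ∈ S, s l = x
      generalize s a = y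
      have h2 : (1 : ZMod 2) + 1 = 0 := by decide
      by_cases hx : x = 0 <;> by_cases hy : y = 0
      · simp [hx, hy]
      · simp [hx, hy]
      · simp [hx, hy]
      · simp [zmod_two_ne_zero.1 hx, zmod_two_ne_zero.1 hy, h2]
  rw [pauliZ, h]

theorem pauliZ_eq_self_iff (S : Finset (Link L)) (ψ : State L) :
    pauliZ S ψ = ψ ↔ ∀ s, ψ s ≠ 0 → ∑ l ∈ S, s l = 0 := by
  rw [funext_iff]
  refine forall_congr' fun s => ?_
  rw [pauliZ_apply]
  by_cases h : ∑ l ∈ S, s l = 0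
  · simp [h]
  · simp only [h, if_false, neg_mul, one_mul, imp_false, not_not, neg_eq_self]

theorem IsXCubeState.apply_add (hL : 3 ≤ L) {ψ : State L} (hψ : IsXCubeState ψ) {c : Config L}
    (hc : c ∈ cubeCode L) (s : Config L) : ψ (s + c) = ψ s := by
  obtain ⟨g, rfl⟩ := hc
  rw [cubeMap_eq_sum hL]
  refine Finset.sum_induction (fun u => g u • ind (cube u)) (fun c => ∀ s, ψ (s + c) = ψ s)
    (fun a b ha hb s => by rw [← add_assoc, hb, ha]) (fun s => by rw [add_zero]) ?_ s
  intro u _ s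
  by_cases h : g u = 0
  · simp [h]
  · rw [zmod_two_ne_zero.1 h, one_smul, ← pauliX_apply _ ψ, hψ.cube_stab]

theorem IsXCubeState.mem_cubeCode (hL : 3 ≤ L) {ψ : State L} (hψ : IsXCubeState ψ) {s : Config L}
    (hs : ψ s ≠ 0) : s ∈ cubeCode L :=
  (mem_cubeCode_iff hL s).2
    ⟨fun v k => (pauliZ_eq_self_iff _ _).1 (hψ.star_stab v k) s hs,
      fun v k d h => (pauliZ_eq_self_iff _ _).1 (hψ.loop_stab v k d h) s hs⟩

open Classical in
theorem IsXCubeState.apply_eq (hL : 3 ≤ L) {ψ : State L} (hψ : IsXCubeState ψ) (s : Config L) :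
    ψ s = if s ∈ cubeCode L then ψ 0 else 0 := by
  split_ifs with h
  · simpa using hψ.apply_add hL h 0
  · by_contra hs
    exact h (hψ.mem_cubeCode hL hs)

variable (L) in
open Classical in
/-- The number of elements of the code. -/
noncomputable def codeCard : ℕ := #(univ.filter fun s : Config L => s ∈ cubeCode L)

variable (L) in
theorem codeCard_pos : 0 < codeCard L :=
  Finset.card_pos.2 ⟨0, by simp⟩

open Classical in
theorem sum_norm_sq_ite (z : ℂ) :
    ∑ s : Config L, ‖if s ∈ cubeCode L then z else 0‖ ^ 2 = codeCard L * ‖z‖ ^ 2 := by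
  have : ∀ s : Config L, ‖if s ∈ cubeCode L then z else 0‖ ^ 2
      = if s ∈ cubeCode L then ‖z‖ ^ 2 else 0 := by
    intro s; split_ifs <;> simp
  simp only [this]
  rw [← Finset.sum_filter, Finset.sum_const, nsmul_eq_mul, codeCard]

theorem IsXCubeState.norm_zero (hL : 3 ≤ L) {ψ : State L} (hψ : IsXCubeState ψ) :
    codeCard L * ‖ψ 0‖ ^ 2 = 1 := by
  classical
  rw [← sum_norm_sq_ite, ← hψ.normalized]
  exact Finset.sum_congr rfl fun s _ => by rw [← hψ.apply_eq hL]

variable (L) in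
theorem exists_isXCubeState (hL : 3 ≤ L) : ∃ ψ : State L, IsXCubeState ψ := by
  classical
  have hpos : (0 : ℝ) < codeCard L := by exact_mod_cast codeCard_pos L
  set z : ℂ := (((Real.sqrt (codeCard L))⁻¹ : ℝ) : ℂ) with hz
  have hsupp : ∀ s : Config L, (if s ∈ cubeCode L then z else 0) ≠ 0 → s ∈ cubeCode L := by
    intro s hs
    by_contra h
    simp [h] at hs
  refine ⟨fun s => if s ∈ cubeCode L then z else 0, ?_, fun u => ?_, fun v k => ?_,
    fun v k d h => ?_⟩
  · rw [sum_norm_sq_ite, hz, Complex.norm_real, Real.norm_eq_abs, sq_abs, inv_pow,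
      Real.sq_sqrt hpos.le, mul_inv_cancel₀ hpos.ne']
  · ext s
    rw [pauliX_apply]
    simp only [(cubeCode L).add_mem_iff_left (ind_cube_mem hL u)]
  · exact (pauliZ_eq_self_iff _ _).2 fun s hs => ((mem_cubeCode_iff hL s).1 (hsupp s hs)).1 v k
  · exact (pauliZ_eq_self_iff _ _).2 fun s hs => ((mem_cubeCode_iff hL s).1 (hsupp s hs)).2 v k d h

theorem IsXCubeState.exists_eq_smul (hL : 3 ≤ L) {ψ φ : State L} (hψ : IsXCubeState ψ)
    (hφ : IsXCubeState φ) : ∃ z : ℂ, ‖z‖ = 1 ∧ φ = z • ψ := by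
  have h1 := hψ.norm_zero hL
  have h2 := hφ.norm_zero hL
  have hpos : (0 : ℝ) < codeCard L := by exact_mod_cast codeCard_pos L
  have heq : ‖φ 0‖ = ‖ψ 0‖ := by
    have : ‖φ 0‖ ^ 2 = ‖ψ 0‖ ^ 2 := mul_left_cancel₀ hpos.ne' (h2.trans h1.symm)
    exact (pow_left_inj₀ (norm_nonneg _) (norm_nonneg _) two_ne_zero).1 this
  have hne : ψ 0 ≠ 0 := by
    intro h
    simp [h] at h1
  refine ⟨φ 0 / ψ 0, by rw [norm_div, heq, div_self (norm_ne_zero_iff.2 hne)], ?_⟩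
  ext s
  classical
  rw [Pi.smul_apply, smul_eq_mul, hφ.apply_eq hL s, hψ.apply_eq hL s]
  split_ifs
  · rw [div_mul_cancel₀ _ hne]
  · simp

/-! ### Entropy of a region containing no element of the code -/

/-- Eigenvalues and diagonal entries are the same multiset, namely the roots of the characteristic
polynomial. -/
theorem sum_comp_eigenvalues_of_eq_diagonal {n : Type*} [Fintype n] [DecidableEq n]
    {M : Matrix n n ℂ} (hM : M.IsHermitian) {D : n → ℝ}
    (hD : M = Matrix.diagonal fun a => (D a : ℂ)) (f : ℝ → ℝ) :
    ∑ i, f (hM.eigenvalues i) = ∑ a, f (D a) := by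
  have h1 := hM.roots_charpoly_eq_eigenvalues
  have h2 : M.charpoly.roots = Multiset.map (fun a => (D a : ℂ)) univ.val := by
    rw [hD, Matrix.charpoly_diagonal]
    rw [← Polynomial.roots_multiset_prod_X_sub_C (Multiset.map (fun a => (D a : ℂ)) univ.val),
      Multiset.map_map]
    rfl
  have h3 := congrArg (fun s : Multiset ℂ => (s.map fun z => f z.re).sum) (h1.symm.trans h2)
  simpa [Multiset.map_map, Function.comp_def] using h3

/-- The restriction of configurations to `A`. -/
def restrict (A : Finset (Link L)) : Config L →ₗ[ZMod 2] ({l // l ∈ A} → ZMod 2) :=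
  LinearMap.funLeft (ZMod 2) (ZMod 2) Subtype.val

theorem restrict_apply (A : Finset (Link L)) (s : Config L) (l : {l // l ∈ A}) :
    restrict A s l = s l := rfl

theorem restrict_glue (A : Finset (Link L)) (a : {l // l ∈ A} → ZMod 2)
    (b : {l // l ∉ A} → ZMod 2) : restrict A (glue A a b) = a := by
  ext l
  simp [restrict_apply, glue]

theorem glue_add (A : Finset (Link L)) (a : {l // l ∈ A} → ZMod 2) (b : {l // l ∉ A} → ZMod 2)
    (c : Config L) :
    glue A (a + restrict A c) (b + fun l : {l // l ∉ A} => c l) = glue A a b + c := by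
  ext l
  by_cases h : l ∈ A <;> simp [glue, h, restrict_apply]

theorem sum_glue (A : Finset (Link L)) (f : Config L → ℝ) :
    ∑ a, ∑ b, f (glue A a b) = ∑ s, f s := by
  rw [← Fintype.sum_prod_type' (f := fun a b => f (glue A a b))]
  exact Equiv.sum_comp (Equiv.piEquivPiSubtypeProd (· ∈ A) fun _ => ZMod 2).symm f

open Classical in
theorem entropy_eq (hL : 3 ≤ L) {ψ : State L} (hψ : IsXCubeState ψ) {A : Finset (Link L)}
    (hA : ∀ c ∈ cubeCode L, (∀ l, l ∉ A → c l = 0) → c = 0) :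
    entropy ψ A = Real.log (#(univ.filter fun a => a ∈ (cubeCode L).map (restrict A)))
      / Real.log 2 := by
  set I := univ.filter fun a => a ∈ (cubeCode L).map (restrict A) with hI
  set D : ({l // l ∈ A} → ZMod 2) → ℝ := fun a => ∑ b, ‖ψ (glue A a b)‖ ^ 2 with hD
  have hdiag : reducedDensity ψ A = Matrix.diagonal fun a => (D a : ℂ) := by
    ext a a'
    by_cases h : a = a'
    · subst h
      rw [Matrix.diagonal_apply_eq, reducedDensity, hD, Complex.ofReal_sum]
      refine Finset.sum_congr rfl fun b _ => ?_
      rw [Complex.star_def, Complex.mul_conj, Complex.normSq_eq_norm_sq]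
    · rw [Matrix.diagonal_apply_ne _ h, reducedDensity]
      -- A nonzero term would give two codewords that agree outside `A`; their difference is
      -- supported on `A`, hence zero.
      refine Finset.sum_eq_zero fun b _ => ?_
      by_contra hne
      have h1 := hψ.mem_cubeCode hL (left_ne_zero_of_mul hne)
      have h2 := hψ.mem_cubeCode hL (star_ne_zero.1 (right_ne_zero_of_mul hne))
      have h3 := hA _ ((cubeCode L).sub_mem h1 h2) fun l hl => by simp [glue, hl]
      apply h
      rw [← restrict_glue A a b, sub_eq_zero.1 h3, restrict_glue]
  have hzero : ∀ a, a ∉ I → D a = 0 := by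
    intro a ha
    refine Finset.sum_eq_zero fun b _ => ?_
    by_contra hne
    refine ha ?_
    rw [hI, mem_filter]
    have hne' : ψ (glue A a b) ≠ 0 := by
      intro h
      simp [h] at hne
    exact ⟨mem_univ _, _, hψ.mem_cubeCode hL hne', restrict_glue A a b⟩
  have hconst : ∀ a, a ∈ I → D a = D 0 := by
    intro a ha
    rw [hI, mem_filter] at ha
    obtain ⟨-, c, hc, rfl⟩ := ha
    simp only [hD]
    -- Translation by the codeword `c` preserves ψ and carries the fibre over 0 to the fibre over
    -- the restriction of `c`.
    rw [← Equiv.sum_comp (Equiv.addRight fun l : {l // l ∉ A} => c l)]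
    refine Finset.sum_congr rfl fun b _ => ?_
    have h := glue_add A 0 b c
    rw [zero_add] at h
    rw [Equiv.coe_addRight, h, hψ.apply_add hL hc]
  have htrace : (#I : ℝ) * D 0 = 1 := by
    rw [← hψ.normalized, ← sum_glue A fun s => ‖ψ s‖ ^ 2,
      ← Finset.sum_subset (Finset.subset_univ I) fun a _ ha => hzero a ha,
      Finset.sum_congr rfl hconst, Finset.sum_const, nsmul_eq_mul]
  have hcard : (#I : ℝ) ≠ 0 := left_ne_zero_of_mul (by rw [htrace]; exact one_ne_zero)
  have hD0 : D 0 = (#I : ℝ)⁻¹ := eq_inv_of_mul_eq_one_right htrace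
  unfold entropy
  rw [sum_comp_eigenvalues_of_eq_diagonal _ hdiag fun x => Real.negMulLog x / Real.log 2,
    ← Finset.sum_subset (Finset.subset_univ I) fun a _ ha => by rw [hzero a ha]; simp,
    Finset.sum_congr rfl fun a ha => by rw [hconst a ha], Finset.sum_const, nsmul_eq_mul, hD0,
    Real.negMulLog, Real.log_inv]
  field_simp

/-- The restriction of the code to `A` is the orthogonal complement of the products of `Z` on
links of `A` which commute with all cubes. -/
theorem mem_map_restrict (hL : 3 ≤ L) {A : Finset (Link L)} {a : {l // l ∈ A} → ZMod 2}
    (h : ∀ w : Config L, (∀ l, l ∉ A → w l = 0) → (∀ u, ∑ l ∈ cube u, w l = 0) →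
      ∑ l, a l * w l = 0) : a ∈ (cubeCode L).map (restrict A) := by
  by_contra ha
  obtain ⟨f, hfa, hf⟩ := Submodule.exists_le_ker_of_notMem ha
  have hsum : ∀ x : {l // l ∈ A} → ZMod 2, f x = ∑ l, x l * f (Pi.single l 1) := by
    intro x
    conv_lhs => rw [← Finset.univ_sum_single x]
    rw [map_sum]
    refine Finset.sum_congr rfl fun l _ => ?_
    rw [← smul_eq_mul, ← map_smul]
    congr 1
    ext l'
    simp [Pi.single_apply]
  -- The coefficients of a functional that vanishes on the restricted code but not at `a`, extended
  -- by zero outside `A`.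
  let w : Config L := fun l => if h : l ∈ A then f (Pi.single ⟨l, h⟩ 1) else 0
  have hw : ∀ l : {l // l ∈ A}, w l = f (Pi.single l 1) := fun l => by simp [w]
  apply hfa
  rw [hsum]
  simp only [← hw]
  refine h w (fun l hl => by simp [w, hl]) fun u => ?_
  have hu : f (restrict A (ind (cube u))) = 0 :=
    hf (Submodule.mem_map_of_mem (ind_cube_mem hL u))
  rw [hsum] at hu
  simp only [← hw, restrict_apply] at hu
  rw [← hu, Finset.sum_coe_sort A fun l => ind (cube u) l * w l]
  simp only [ind, ite_mul, one_mul, zero_mul]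
  rw [← Finset.sum_filter, Finset.filter_mem_eq_inter]
  refine (Finset.sum_subset Finset.inter_subset_right fun l hl hl' => ?_).symm
  have : l ∉ A := fun h => hl' (mem_inter.2 ⟨h, hl⟩)
  simp [w, this]

theorem zeta_eq_zero (hL : 3 ≤ L) {ψ : State L} (hψ : IsXCubeState ψ) {A : Finset (Link L)}
    (hA : ∀ c ∈ cubeCode L, (∀ l, l ∉ A → c l = 0) → c = 0)
    (hA' : ∀ w : Config L, (∀ l, l ∉ A → w l = 0) → (∀ u, ∑ l ∈ cube u, w l = 0) → w = 0) :
    zeta ψ A = 0 := by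
  classical
  have h2 : Real.log 2 ≠ 0 := (Real.log_pos one_lt_two).ne'
  rw [zeta, entropy_eq hL hψ hA, Finset.filter_true_of_mem]
  · simp [h2]
  · intro a _
    refine mem_map_restrict hL fun w hw hw' => ?_
    simp [hA' w hw hw']

theorem card_sum_eq_zero {ι : Type*} [Fintype ι] [DecidableEq ι] (i : ι) :
    2 * #(univ.filter fun a : ι → ZMod 2 => ∑ l, a l = 0) = 2 ^ Fintype.card ι := by
  have h : #(univ.filter fun a : ι → ZMod 2 => ∑ l, a l = 0)
      = #(univ.filter fun a : ι → ZMod 2 => ¬ ∑ l, a l = 0) := by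
    -- Flipping the coordinate `i` exchanges even and odd vectors.
    refine Finset.card_equiv (Equiv.addRight (Pi.single i 1)) fun a => ?_
    simp only [mem_filter, mem_univ, true_and, Equiv.coe_addRight, Pi.add_apply,
      Finset.sum_add_distrib, Finset.sum_pi_single']
    generalize ∑ l, a l = x
    simp only [if_true]
    revert x; decide
  have h' := Finset.card_filter_add_card_filter_not (s := univ)
    (fun a : ι → ZMod 2 => ∑ l, a l = 0)
  rw [← h, Finset.card_univ] at h'
  rw [two_mul, h']
  simp

theorem zeta_eq_neg_one (hL : 3 ≤ L) {ψ : State L} (hψ : IsXCubeState ψ) {A : Finset (Link L)}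
    (hne : A.Nonempty) (hA : ∀ c ∈ cubeCode L, (∀ l, l ∉ A → c l = 0) → c = 0)
    (hcube : ∀ u, ∑ l ∈ cube u, ind A l = 0)
    (hA' : ∀ w : Config L, (∀ l, l ∉ A → w l = 0) → (∀ u, ∑ l ∈ cube u, w l = 0) →
      w = 0 ∨ w = ind A) :
    zeta ψ A = -1 := by
  classical
  have h2 : Real.log 2 ≠ 0 := (Real.log_pos one_lt_two).ne'
  obtain ⟨i, hi⟩ := hne
  have hsum : ∀ c ∈ cubeCode L, ∑ l ∈ A, c l = 0 := by
    rintro _ ⟨g, rfl⟩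
    rw [cubeMap_eq_sum hL]
    simp only [Finset.sum_apply, Pi.smul_apply]
    rw [Finset.sum_comm]
    refine Finset.sum_eq_zero fun u _ => ?_
    rw [← Finset.smul_sum, sum_ind_comm, hcube, smul_zero]
  have hI : (univ.filter fun a => a ∈ (cubeCode L).map (restrict A))
      = univ.filter fun a => ∑ l, a l = 0 := by
    refine Finset.filter_congr fun a _ => ⟨?_, fun h => mem_map_restrict hL fun w hw hw' => ?_⟩
    · rintro ⟨c, hc, rfl⟩
      simp only [restrict_apply]
      rw [Finset.sum_coe_sort A c, hsum c hc]
    · rcases hA' w hw hw' with rfl | rfl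
      · simp
      · simpa [ind] using h
  have hcard := card_sum_eq_zero (⟨i, hi⟩ : {l // l ∈ A})
  rw [Fintype.card_coe] at hcard
  have hlog := congrArg (fun n : ℕ => Real.log n) hcard
  have hne : (#(univ.filter fun a : {l // l ∈ A} → ZMod 2 => ∑ l, a l = 0) : ℝ) ≠ 0 := by
    intro h
    rw [Nat.cast_eq_zero] at h
    rw [h] at hcard
    exact (pow_ne_zero #A two_ne_zero) hcard.symm
  push_cast at hlog
  rw [Real.log_mul two_ne_zero hne, Real.log_pow] at hlog
  rw [zeta, entropy_eq hL hψ hA, hI, eq_sub_of_add_eq' hlog]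
  field_simp
  ring

/-! ### Links on a common cube -/

/-- A cube containing `l` may have its lowest corner at the `m`-coordinate `x`. -/
def Near (l : Link L) (m : Fin 3) (x : ZMod L) : Prop :=
  x = l.1 m ∨ m ≠ l.2 ∧ x = l.1 m - 1

theorem mem_cube_iff (l : Link L) (v : Vertex L) : l ∈ cube v ↔ ∀ m, Near l m (v m) := by
  simp only [cube, mem_filter, mem_univ, true_and, Near]
  constructor
  · rintro ⟨h, h'⟩ m
    by_cases hm : m = l.2
    · subst hm; exact Or.inl h.symm
    · rcases h' m hm with h | h
      · exact Or.inl h.symm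
      · exact Or.inr ⟨hm, eq_sub_of_add_eq h.symm⟩
  · intro h
    refine ⟨?_, fun j hj => ?_⟩
    · rcases h l.2 with h | h
      · exact h.symm
      · exact absurd rfl h.1
    · rcases h j with h | h
      · exact Or.inl h.symm
      · exact Or.inr (by rw [h.2, sub_add_cancel])

theorem one_ne_zero_zmod (hL : 3 ≤ L) : (1 : ZMod L) ≠ 0 := by
  have : Fact (1 < L) := ⟨by omega⟩
  exact one_ne_zero

theorem two_ne_zero_zmod (hL : 3 ≤ L) : (2 : ZMod L) ≠ 0 := by
  intro h
  have h' : ((2 : ℕ) : ZMod L) = 0 := by exact_mod_cast h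
  rw [ZMod.natCast_eq_zero_iff] at h'
  exact absurd (Nat.le_of_dvd two_pos h') (by omega)

/-- A link lying on both sides of a lattice plane lies in the plane. Here `L = 2` must be excluded:
the two offsets could otherwise be swapped by wrapping around. -/
theorem near_both (hL : 3 ≤ L) {a : Link L} {m : Fin 3} {x : ZMod L} (h : Near a m x)
    (h' : Near a m (x - 1)) : a.2 ≠ m ∧ a.1 m = x := by
  have h1 := one_ne_zero_zmod hL
  have h2 := two_ne_zero_zmod hL
  rcases h with h | ⟨hm, h⟩ <;> rcases h' with h' | ⟨hm', h'⟩
  · exact absurd (by linear_combination h - h') h1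
  · exact ⟨hm'.symm, h.symm⟩
  · exact absurd (by linear_combination h - h') h2
  · exact absurd (by linear_combination h - h') h1

theorem mem_cube_update {l : Link L} {v : Vertex L} {k : Fin 3} {x : ZMod L} (h : l ∈ cube v)
    (hx : Near l k x) : l ∈ cube (Function.update v k x) := by
  rw [mem_cube_iff] at h ⊢
  intro m
  by_cases hm : m = k
  · subst hm; simpa using hx
  · simpa [hm] using h m

theorem mem_plaquette_iff (l : Link L) (v : Vertex L) (k : Fin 3) :
    l ∈ plaquette v k ↔ l ∈ cube v ∧ l.2 ≠ k ∧ l.1 k = v k := by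
  simp [plaquette]

theorem mem_plane_iff (l : Link L) (k : Fin 3) (h : ZMod L) :
    l ∈ plane k h ↔ l.2 ≠ k ∧ l.1 k = h := by
  simp [plane]

theorem direction_eq {k k' x y : Fin 3} (h : k ≠ k') (hx : x ≠ k) (hy : y ≠ k) (hx' : x ≠ k')
    (hy' : y ≠ k') : x = y := by
  revert k k' x y; decide

theorem direction_cases {d k m : Fin 3} (h : d ≠ k) (hmd : m ≠ d) (hmk : m ≠ k) (x : Fin 3) :
    x = d ∨ x = k ∨ x = m := by
  revert d k m x; decide

theorem link_eq_of_near {l a : Link L} {j k : Fin 3} (hdj : l.2 ≠ j) (hdk : l.2 ≠ k) (hjk : j ≠ k)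
    (hd : Near a l.2 (l.1 l.2)) (haj : a.2 ≠ j ∧ a.1 j = l.1 j) (hak : a.2 ≠ k ∧ a.1 k = l.1 k) :
    a = l := by
  obtain ⟨w, d⟩ := l
  obtain ⟨w', d'⟩ := a
  simp only at *
  obtain ⟨haj, haj'⟩ := haj
  obtain ⟨hak, hak'⟩ := hak
  have hd' : d' = d := direction_eq hjk haj hdj hak hdk
  subst hd'
  have hm := direction_cases hdj hdk.symm hjk.symm
  rw [Prod.mk.injEq]
  refine ⟨?_, rfl⟩
  ext m
  rcases hm m with rfl | rfl | rfl
  · rcases hd with h | h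
    · exact h.symm
    · exact absurd rfl h.1
  · exact haj'
  · exact hak'

/-- Two planes with different normals meet in a line, and a cube contains at most one link of a
given line. -/
theorem eq_of_mem_planes {a l : Link L} {v : Vertex L} (hne : a ≠ l) (ha : a ∈ cube v)
    (hl : l ∈ cube v) {k k' : Fin 3} {h h' : ZMod L} (hak : a ∈ plane k h) (hlk : l ∈ plane k h)
    (hak' : a ∈ plane k' h') (hlk' : l ∈ plane k' h') : k = k' ∧ h = h' := by
  rw [mem_plane_iff] at hak hlk hak' hlk'
  have hkk : k = k' := by
    by_contra hkk
    have hd : a.2 = l.2 := direction_eq hkk hak.1 hlk.1 hak'.1 hlk'.1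
    refine hne (link_eq_of_near hlk.1 hlk'.1 hkk (Or.inl ?_) ⟨hak.1, hak.2.trans hlk.2.symm⟩
      ⟨hak'.1, hak'.2.trans hlk'.2.symm⟩)
    have h1 := ((mem_cube_iff _ _).1 ha) a.2
    have h2 := ((mem_cube_iff _ _).1 hl) l.2
    rw [hd] at h1
    simp only [Near, hd, ne_eq, not_true_eq_false, false_and, or_false] at h1 h2
    rw [← h1, ← h2]
  subst hkk
  exact ⟨rfl, hak.2.symm.trans hak'.2⟩

/-- `l` and `a` lie on a common plaquette perpendicular to `k`. -/
def SharePlaquette (l a : Link L) (k : Fin 3) : Prop :=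
  ∃ v, v k = l.1 k ∧ l ∈ plaquette v k ∧ a ∈ plaquette v k

theorem mem_cube_self (l : Link L) : l ∈ cube l.1 :=
  (mem_cube_iff _ _).2 fun _ => Or.inl rfl

/-- If every cube containing `l` contains one of `a`, `b`, then these links lie in a plane, on
different sides of `l`. -/
theorem coplanar_of_cover (hL : 3 ≤ L) {l a b : Link L} (ha : a ≠ l) (hb : b ≠ l)
    (h : ∀ v, l ∈ cube v → a ∈ cube v ∨ b ∈ cube v) :
    ∃ k, SharePlaquette l a k ∧ SharePlaquette l b k ∧
      ∀ v, l ∈ cube v → a ∈ cube v → b ∉ cube v := by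
  obtain ⟨w, d⟩ := l
  obtain ⟨j, k, hdj, hdk, hjk, hall⟩ := exists_others d
  -- `P x y` with x ∈ {w j, w j - 1} and y ∈ {w k, w k - 1} gives the four cubes around the link.
  -- Those containing a given other link form a subrectangle of this 2 × 2 grid.
  let P : ZMod L → ZMod L → Vertex L := fun x y m => if m = d then w d else if m = j then x else y
  have hPd : ∀ x y, P x y d = w d := fun x y => by simp [P]
  have hPj : ∀ x y, P x y j = x := fun x y => by simp [P, hdj.symm]
  have hPk : ∀ x y, P x y k = y := fun x y => by simp [P, hdk.symm, hjk.symm]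
  have hP : ∀ (c : Link L) x y,
      c ∈ cube (P x y) ↔ Near c d (w d) ∧ Near c j x ∧ Near c k y := by
    intro c x y
    rw [mem_cube_iff]
    constructor
    · intro h
      have h1 := h d
      have h2 := h j
      have h3 := h k
      rw [hPd] at h1
      rw [hPj] at h2
      rw [hPk] at h3
      exact ⟨h1, h2, h3⟩
    · rintro ⟨h1, h2, h3⟩ m
      rcases hall m with rfl | rfl | rfl
      · rwa [hPd]
      · rwa [hPj]
      · rwa [hPk]
  have hself : ∀ v : Vertex L, (w, d) ∈ cube v ↔
      v d = w d ∧ (v j = w j ∨ v j = w j - 1) ∧ (v k = w k ∨ v k = w k - 1) := by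
    intro v
    rw [mem_cube_iff]
    constructor
    · intro h
      have h1 := h d
      have h2 := h j
      have h3 := h k
      simp only [Near, hdj.symm, hdk.symm, ne_eq, not_true_eq_false, false_and, or_false,
        not_false_eq_true, true_and] at h1 h2 h3
      exact ⟨h1, h2, h3⟩
    · rintro ⟨h1, h2, h3⟩ m
      rcases hall m with rfl | rfl | rfl
      · exact Or.inl h1
      · simpa [Near, hdj.symm] using h2
      · simpa [Near, hdk.symm] using h3
  have hPself : ∀ x y, (x = w j ∨ x = w j - 1) → (y = w k ∨ y = w k - 1) →
      (w, d) ∈ cube (P x y) := by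
    intro x y hx hy
    rw [hself, hPd, hPj, hPk]
    exact ⟨rfl, hx, hy⟩
  have hvP : ∀ v : Vertex L, v d = w d → v = P (v j) (v k) := by
    intro v hv
    ext m
    rcases hall m with rfl | rfl | rfl
    · rw [hPd, hv]
    · rw [hPj]
    · rw [hPk]
  have notfull : ∀ c : Link L, c ≠ (w, d) → ¬ (Near c d (w d) ∧ Near c j (w j) ∧
      Near c j (w j - 1) ∧ Near c k (w k) ∧ Near c k (w k - 1)) := by
    rintro c hc ⟨h1, h2, h3, h4, h5⟩
    exact hc (link_eq_of_near (l := (w, d)) hdj hdk hjk h1 (near_both hL h2 h3)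
      (near_both hL h4 h5))
  have c00 := h _ (hPself (w j) (w k) (Or.inl rfl) (Or.inl rfl))
  have c01 := h _ (hPself (w j) (w k - 1) (Or.inl rfl) (Or.inr rfl))
  have c10 := h _ (hPself (w j - 1) (w k) (Or.inr rfl) (Or.inl rfl))
  have c11 := h _ (hPself (w j - 1) (w k - 1) (Or.inr rfl) (Or.inr rfl))
  have na := notfull a ha
  have nb := notfull b hb
  rw [hP, hP] at c00 c01 c10 c11
  have hplane : ∀ c m, d ≠ m → Near c m (w m) → Near c m (w m - 1) → ∀ v, v m = w m →
      (w, d) ∈ cube v → c ∈ cube v → (w, d) ∈ plaquette v m ∧ c ∈ plaquette v m := by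
    intro c m hdm hc hc' v hvm hv hcv
    obtain ⟨h1, h2⟩ := near_both hL hc hc'
    rw [mem_plaquette_iff, mem_plaquette_iff, hvm]
    exact ⟨⟨hv, hdm, rfl⟩, hcv, h1, h2⟩
  have hshare_j : ∀ c, Near c d (w d) → Near c j (w j) → Near c j (w j - 1) →
      (Near c k (w k) ∨ Near c k (w k - 1)) → SharePlaquette (w, d) c j := by
    intro c h1 h2 h3 h4
    rcases h4 with h4 | h4
    · exact ⟨P (w j) (w k), hPj _ _, hplane c j hdj h2 h3 _ (hPj _ _)
        (hPself _ _ (Or.inl rfl) (Or.inl rfl)) ((hP _ _ _).2 ⟨h1, h2, h4⟩)⟩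
    · exact ⟨P (w j) (w k - 1), hPj _ _, hplane c j hdj h2 h3 _ (hPj _ _)
        (hPself _ _ (Or.inl rfl) (Or.inr rfl)) ((hP _ _ _).2 ⟨h1, h2, h4⟩)⟩
  have hshare_k : ∀ c, Near c d (w d) → Near c k (w k) → Near c k (w k - 1) →
      (Near c j (w j) ∨ Near c j (w j - 1)) → SharePlaquette (w, d) c k := by
    intro c h1 h2 h3 h4
    rcases h4 with h4 | h4
    · exact ⟨P (w j) (w k), hPk _ _, hplane c k hdk h2 h3 _ (hPk _ _)
        (hPself _ _ (Or.inl rfl) (Or.inl rfl)) ((hP _ _ _).2 ⟨h1, h4, h2⟩)⟩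
    · exact ⟨P (w j - 1) (w k), hPk _ _, hplane c k hdk h2 h3 _ (hPk _ _)
        (hPself _ _ (Or.inr rfl) (Or.inl rfl)) ((hP _ _ _).2 ⟨h1, h4, h2⟩)⟩
  have htriple : ∀ v, (w, d) ∈ cube v → a ∈ cube v → b ∈ cube v →
      (Near a j (w j) ∧ Near b j (w j) ∨ Near a j (w j - 1) ∧ Near b j (w j - 1)) ∧
      (Near a k (w k) ∧ Near b k (w k) ∨ Near a k (w k - 1) ∧ Near b k (w k - 1)) := by
    intro v hv hav hbv
    have hv' := (hself v).1 hv
    rw [mem_cube_iff] at hav hbv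
    refine ⟨?_, ?_⟩
    · have h1 := hav j
      have h2 := hbv j
      rcases hv'.2.1 with h | h <;> rw [h] at h1 h2
      · exact Or.inl ⟨h1, h2⟩
      · exact Or.inr ⟨h1, h2⟩
    · have h1 := hav k
      have h2 := hbv k
      rcases hv'.2.2 with h | h <;> rw [h] at h1 h2
      · exact Or.inl ⟨h1, h2⟩
      · exact Or.inr ⟨h1, h2⟩
  -- Neither rectangle is the full grid by `notfull`, so two that cover it must be complementary
  -- parallel dominoes; their direction decides between `j` and `k`.
  have hcase : (SharePlaquette (w, d) a j ∧ SharePlaquette (w, d) b j ∧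
      ¬ (Near a k (w k) ∧ Near b k (w k)) ∧ ¬ (Near a k (w k - 1) ∧ Near b k (w k - 1))) ∨
      (SharePlaquette (w, d) a k ∧ SharePlaquette (w, d) b k ∧
      ¬ (Near a j (w j) ∧ Near b j (w j)) ∧ ¬ (Near a j (w j - 1) ∧ Near b j (w j - 1))) := by
    have ja := hshare_j a
    have jb := hshare_j b
    have ka := hshare_k a
    have kb := hshare_k b
    clear hshare_j hshare_k htriple hplane notfull hvP hPself hself hP hPd hPj hPk h ha hb hall
    grind
  rcases hcase with ⟨h1, h2, h3, h4⟩ | ⟨h1, h2, h3, h4⟩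
  · exact ⟨j, h1, h2, fun v hv hav hbv => (htriple v hv hav hbv).2.elim h3 h4⟩
  · exact ⟨k, h1, h2, fun v hv hav hbv => (htriple v hv hav hbv).1.elim h3 h4⟩

/-! ### Dual curves and cubes -/

theorem mem_of_preconnected_induce {V : Type*} {H : SimpleGraph V} {S X : Set V}
    (h : (H.induce S).Preconnected)
    (hX : ∀ a ∈ X, a ∈ S → ∀ b ∈ S, H.Adj a b → b ∈ X) {i j : V} (hi : i ∈ S) (hiX : i ∈ X)
    (hj : j ∈ S) : j ∈ X := by
  obtain ⟨p⟩ := h ⟨i, hi⟩ ⟨j, hj⟩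
  have : ∀ (a b : S), (H.induce S).Walk a b → (a : V) ∈ X → (b : V) ∈ X := by
    intro a b p
    induction p with
    | nil => exact id
    | cons hadj _ ih => exact fun ha => ih (hX _ ha (Subtype.coe_prop _) _ (Subtype.coe_prop _) hadj)
  exact this _ _ p hiX

theorem mem_of_preconnected {V : Type*} {H : SimpleGraph V} {X : Set V} (h : H.Preconnected)
    (hX : ∀ a ∈ X, ∀ b, H.Adj a b → b ∈ X) {i : V} (hiX : i ∈ X) (j : V) : j ∈ X := by
  obtain ⟨p⟩ := h i j
  induction p with
  | nil => exact hiX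
  | cons hadj _ ih => exact ih (hX _ hiX _ hadj)

/-- Every vertex of `H` has at most two neighbours. -/
def DegreeLeTwo {V : Type*} (H : SimpleGraph V) : Prop :=
  ∀ i, ∃ p q, ∀ j, H.Adj i j → j = p ∨ j = q

theorem DegreeLeTwo.eq_or_eq {V : Type*} {H : SimpleGraph V} (h : DegreeLeTwo H) {i p q j : V}
    (hp : H.Adj i p) (hq : H.Adj i q) (hpq : p ≠ q) (hj : H.Adj i j) : j = p ∨ j = q := by
  obtain ⟨x, y, hxy⟩ := h i
  have h1 := hxy p hp
  have h2 := hxy q hq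
  have h3 := hxy j hj
  grind

namespace IsDualCurve

variable {n : ℕ} {H : SimpleGraph (Fin n)} {ℓ : Fin n → Link L}

theorem false_of_plaquette (hc : IsDualCurve H ℓ) {v : Vertex L} {k : Fin 3} {i p q : Fin n}
    (hip : i ≠ p) (hiq : i ≠ q) (hpq : p ≠ q) (hi : ℓ i ∈ plaquette v k)
    (hp : ℓ p ∈ plaquette v k) (hq : ℓ q ∈ plaquette v k) : False := by
  have h : ({i, p, q} : Finset (Fin n)) ⊆ univ.filter fun i => ℓ i ∈ plaquette v k := by
    intro x hx
    simp only [mem_insert, mem_singleton] at hx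
    rcases hx with rfl | rfl | rfl <;> simp [*]
  have h' := (Finset.card_le_card h).trans (hc.plaquette_card v k)
  rw [Finset.card_eq_three.2 ⟨i, p, q, hip, hiq, hpq, rfl⟩] at h'
  omega

/-- The links of the string on a cube are consecutive, so a second link of `T` on a cube containing
`ℓ i` forces a neighbour of `i` onto that cube. `coplanar_of_cover` then applies. -/
theorem exists_neighbors (hL : 3 ≤ L) (hc : IsDualCurve H ℓ) (hdeg : DegreeLeTwo H)
    {T : Set (Fin n)}
    (hT : ∀ v, ∀ i ∈ T, ℓ i ∈ cube v → ∃ j ∈ T, j ≠ i ∧ ℓ j ∈ cube v) {i : Fin n} (hi : i ∈ T) :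
    ∃ p q k, p ≠ q ∧ H.Adj i p ∧ H.Adj i q ∧ SharePlaquette (ℓ i) (ℓ p) k ∧
      SharePlaquette (ℓ i) (ℓ q) k ∧ ∀ v, ℓ i ∈ cube v → ℓ p ∈ cube v → ℓ q ∉ cube v := by
  have hnb : ∀ v, ℓ i ∈ cube v → ∃ p, H.Adj i p ∧ ℓ p ∈ cube v := by
    intro v hv
    by_contra! hno
    obtain ⟨j, -, hji, hjv⟩ := hT v i hi hv
    refine hji (mem_of_preconnected_induce (X := {i}) (hc.cube_connected v) ?_ hv rfl hjv)
    rintro a rfl - b hb hab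
    exact absurd hb (hno b hab)
  obtain ⟨p₀, hp₀, -⟩ := hnb _ (mem_cube_self _)
  -- `p = q` is allowed for now, in case there is a single neighbour; the separation property rules
  -- it out at the end.
  obtain ⟨p, q, hp, hq, hpq⟩ : ∃ p q, H.Adj i p ∧ H.Adj i q ∧ ∀ j, H.Adj i j → j = p ∨ j = q := by
    by_cases h : ∃ q₀, H.Adj i q₀ ∧ p₀ ≠ q₀
    · obtain ⟨q₀, hq₀, hne⟩ := h
      exact ⟨p₀, q₀, hp₀, hq₀, fun j hj => hdeg.eq_or_eq hp₀ hq₀ hne hj⟩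
    · push Not at h
      exact ⟨p₀, p₀, hp₀, hp₀, fun j hj => Or.inl (h j hj).symm⟩
  obtain ⟨k, h1, h2, h3⟩ := coplanar_of_cover hL
    (fun h => hp.ne (hc.injective h).symm) (fun h => hq.ne (hc.injective h).symm)
    (fun v hv => by
      obtain ⟨r, hr, hrv⟩ := hnb v hv
      rcases hpq r hr with rfl | rfl
      · exact Or.inl hrv
      · exact Or.inr hrv)
  refine ⟨p, q, k, ?_, hp, hq, h1, h2, h3⟩
  rintro rfl
  obtain ⟨v, -, hv, hv'⟩ := h1
  rw [mem_plaquette_iff] at hv hv'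
  exact h3 v hv.1 hv'.1 hv'.1

/-- If `p` were not in `T`, the other link of `T` required on each cube shared by `i` and `p` could
only be reached through the next link after `p`. That link would lie on the cubes on both sides of
the plane, hence be a third link on their common plaquette. -/
theorem neighbor_mem (hL : 3 ≤ L) (hc : IsDualCurve H ℓ) (hdeg : DegreeLeTwo H)
    {T : Set (Fin n)}
    (hT : ∀ v, ∀ i ∈ T, ℓ i ∈ cube v → ∃ j ∈ T, j ≠ i ∧ ℓ j ∈ cube v) {i : Fin n} (hi : i ∈ T)
    {p q : Fin n} {k : Fin 3} (hpq : p ≠ q) (hp : H.Adj i p) (hq : H.Adj i q)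
    (hshare : SharePlaquette (ℓ i) (ℓ p) k)
    (hsep : ∀ v, ℓ i ∈ cube v → ℓ p ∈ cube v → ℓ q ∉ cube v) : p ∈ T := by
  by_contra hpT
  have key : ∀ v, ℓ i ∈ cube v → ℓ p ∈ cube v → ∃ r, r ≠ i ∧ H.Adj p r ∧ ℓ r ∈ cube v := by
    intro v hiv hpv
    by_contra! hno
    obtain ⟨j, hjT, hji, hjv⟩ := hT v i hi hiv
    have hj := mem_of_preconnected_induce (X := {i, p}) (hc.cube_connected v) (by
      rintro a (rfl | rfl) - b hb hab
      · rcases hdeg.eq_or_eq hp hq hpq hab with rfl | rfl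
        · exact Or.inr rfl
        · exact absurd hb (hsep v hiv hpv)
      · by_contra hb'
        exact hno b (fun h => hb' (Or.inl h)) hab hb) hiv (Or.inl rfl) hjv
    rcases hj with rfl | rfl
    · exact hji rfl
    · exact hpT hjT
  obtain ⟨v, hvk, hiv, hpv⟩ := hshare
  have hiv' := (mem_plaquette_iff _ _ _).1 hiv
  have hpv' := (mem_plaquette_iff _ _ _).1 hpv
  obtain ⟨r, hri, hpr, hrv⟩ := key v hiv'.1 hpv'.1
  obtain ⟨r', hri', hpr', hrv'⟩ := key (Function.update v k (v k - 1))
    (mem_cube_update hiv'.1 (Or.inr ⟨hiv'.2.1.symm, by rw [hiv'.2.2]⟩))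
    (mem_cube_update hpv'.1 (Or.inr ⟨hpv'.2.1.symm, by rw [hpv'.2.2]⟩))
  have hrr : r' = r := (hdeg.eq_or_eq hp.symm hpr hri.symm hpr').resolve_left hri'
  subst hrr
  have h1 := (mem_cube_iff _ _).1 hrv k
  have h2 := (mem_cube_iff _ _).1 hrv' k
  rw [Function.update_self] at h2
  exact hc.false_of_plaquette hp.ne hri'.symm hpr.ne hiv hpv
    ((mem_plaquette_iff _ _ _).2 ⟨hrv, near_both hL h1 h2⟩)

theorem eq_univ_and_planar (hL : 3 ≤ L) (hc : IsDualCurve H ℓ) (hdeg : DegreeLeTwo H)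
    (hconn : H.Preconnected) {T : Set (Fin n)}
    (hT : ∀ v, ∀ i ∈ T, ℓ i ∈ cube v → ∃ j ∈ T, j ≠ i ∧ ℓ j ∈ cube v) (hne : T.Nonempty) :
    (∀ i, i ∈ T) ∧ (∀ i, ∃ p q, p ≠ q ∧ H.Adj i p ∧ H.Adj i q) ∧
      ∃ k h, ∀ i, ℓ i ∈ plane k h := by
  obtain ⟨i₀, hi₀⟩ := hne
  have hall : ∀ i, i ∈ T := by
    refine mem_of_preconnected hconn ?_ hi₀
    intro a ha b hab
    obtain ⟨p, q, k, hpq, hp, hq, h1, h2, h3⟩ := hc.exists_neighbors hL hdeg hT ha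
    rcases hdeg.eq_or_eq hp hq hpq hab with rfl | rfl
    · exact hc.neighbor_mem hL hdeg hT ha hpq hp hq h1 h3
    · exact hc.neighbor_mem hL hdeg hT ha hpq.symm hq hp h2 fun v h h' h'' => h3 v h h'' h'
  have hplane : ∀ i, ∃ k h, ℓ i ∈ plane k h ∧ ∀ p, H.Adj i p → ℓ p ∈ plane k h := by
    intro i
    obtain ⟨p, q, k, hpq, hp, hq, ⟨v, hv, h1, h1'⟩, ⟨v', hv', h2, h2'⟩, -⟩ :=
      hc.exists_neighbors hL hdeg hT (hall i)
    rw [mem_plaquette_iff] at h1 h1' h2 h2'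
    refine ⟨k, (ℓ i).1 k, (mem_plane_iff _ _ _).2 ⟨h1.2.1, rfl⟩, fun r hr => ?_⟩
    rcases hdeg.eq_or_eq hp hq hpq hr with rfl | rfl
    · exact (mem_plane_iff _ _ _).2 ⟨h1'.2.1, h1'.2.2.trans hv⟩
    · exact (mem_plane_iff _ _ _).2 ⟨h2'.2.1, h2'.2.2.trans hv'⟩
  refine ⟨hall, fun i => ?_, ?_⟩
  · obtain ⟨p, q, k, hpq, hp, hq, -⟩ := hc.exists_neighbors hL hdeg hT (hall i)
    exact ⟨p, q, hpq, hp, hq⟩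
  · obtain ⟨k, h, hi, hnb⟩ := hplane i₀
    refine ⟨k, h, fun i => ?_⟩
    refine (mem_of_preconnected hconn
      (X := {i | ℓ i ∈ plane k h ∧ ∀ p, H.Adj i p → ℓ p ∈ plane k h}) ?_ ⟨hi, hnb⟩ i).1
    rintro a ⟨ha, ha'⟩ b hab
    obtain ⟨k', h', hb, hb'⟩ := hplane b
    obtain ⟨v, hav, hbv⟩ := hc.consecutive a b hab
    -- The planes attached to adjacent links both contain these two distinct links of one cube, so
    -- they coincide.
    obtain ⟨rfl, rfl⟩ := eq_of_mem_planes (fun h => hab.ne (hc.injective h)) hav hbv ha (ha' b hab)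
      (hb' a hab.symm) hb
    exact ⟨hb, hb'⟩

/-- A product of `Z` on links of a dual curve which commutes with all cubes is trivial, unless the
curve is closed and planar. -/
theorem eq_ind_of_ne_zero (hL : 3 ≤ L) (hc : IsDualCurve H ℓ) (hdeg : DegreeLeTwo H)
    (hconn : H.Preconnected) {w : Config L} (hw : ∀ l, l ∉ univ.image ℓ → w l = 0)
    (hcube : ∀ u, ∑ l ∈ cube u, w l = 0) (hne : w ≠ 0) :
    w = ind (univ.image ℓ) ∧ (∀ i, ∃ p q, p ≠ q ∧ H.Adj i p ∧ H.Adj i q) ∧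
      IsPlanar (univ.image ℓ) := by
  have himage : ∀ l, w l ≠ 0 → ∃ i, ℓ i = l := by
    intro l hl
    have : l ∈ univ.image ℓ := by_contra fun h => hl (hw l h)
    simpa using this
  obtain ⟨hall, hnb, k, h, hplane⟩ := hc.eq_univ_and_planar hL hdeg hconn
    (T := {i | w (ℓ i) ≠ 0}) (by
      intro v i hi hiv
      by_contra! hno
      apply hi
      rw [← hcube v]
      symm
      refine Finset.sum_eq_single (ℓ i) (fun l hl hli => ?_) fun h => absurd hiv h
      by_contra hl0
      obtain ⟨j, rfl⟩ := himage l hl0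
      exact hno j hl0 (fun h => hli (h ▸ rfl)) hl) (by
      obtain ⟨l, hl⟩ := Function.ne_iff.1 hne
      obtain ⟨i, rfl⟩ := himage l hl
      exact ⟨i, hl⟩)
  refine ⟨?_, hnb, k, h, fun l hl => ?_⟩
  · ext l
    by_cases hl : l ∈ univ.image ℓ
    · obtain ⟨i, -, rfl⟩ := Finset.mem_image.1 hl
      rw [ind, if_pos hl]
      exact zmod_two_ne_zero.1 (hall i)
    · rw [ind, if_neg hl, hw l hl]
  · obtain ⟨i, -, rfl⟩ := Finset.mem_image.1 hl
    exact hplane i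

/-- For links of the plane, lying on a cube amounts to lying on its face in that plane, which holds
at most two of them. The two neighbours of a link cannot share one of its two plaquettes in the
plane, so each plaquette that is met contains exactly two links. -/
theorem sum_cube_ind (hc : IsDualCurve H ℓ)
    (hnb : ∀ i, ∃ p q, p ≠ q ∧ H.Adj i p ∧ H.Adj i q) {k : Fin 3} {h : ZMod L}
    (hplane : ∀ i, ℓ i ∈ plane k h) (u : Vertex L) :
    ∑ l ∈ cube u, ind (univ.image ℓ) l = 0 := by
  have hcard : #(cube u ∩ univ.image ℓ) = #(univ.filter fun i => ℓ i ∈ cube u) := by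
    rw [← Finset.card_image_of_injective _ hc.injective]
    congr 1
    ext l
    simp only [mem_inter, mem_image, mem_filter, mem_univ, true_and]
    constructor
    · rintro ⟨hl, i, rfl⟩
      exact ⟨i, hl, rfl⟩
    · rintro ⟨i, hl, rfl⟩
      exact ⟨hl, i, rfl⟩
  rw [sum_ind, hcard, ZMod.natCast_eq_zero_iff_even]
  rcases (univ.filter fun i => ℓ i ∈ cube u).eq_empty_or_nonempty with h0 | ⟨i, hi⟩
  · rw [h0]; simp
  rw [mem_filter] at hi
  replace hi := hi.2
  have hproj : ∀ v j, ℓ j ∈ cube v → ℓ j ∈ plaquette (Function.update v k h) k := by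
    intro v j hj
    obtain ⟨h1, h2⟩ := (mem_plane_iff _ _ _).1 (hplane j)
    exact (mem_plaquette_iff _ _ _).2 ⟨mem_cube_update hj (Or.inl h2.symm), h1, by simpa using h2⟩
  have huk : u k = h ∨ u k = h - 1 := by
    have h1 := (mem_cube_iff _ _).1 hi k
    rw [Near, ((mem_plane_iff _ _ _).1 (hplane i)).2] at h1
    exact h1.imp id And.right
  have hiff : ∀ j, ℓ j ∈ cube u ↔ ℓ j ∈ plaquette (Function.update u k h) k := by
    refine fun j => ⟨hproj u j, fun hj => ?_⟩
    obtain ⟨h1, h2⟩ := (mem_plane_iff _ _ _).1 (hplane j)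
    have := mem_cube_update (k := k) (x := u k) ((mem_plaquette_iff _ _ _).1 hj).1
      (by rw [Near, h2]; exact huk.imp id fun h => ⟨h1.symm, h⟩)
    simpa using this
  have hle : #(univ.filter fun i => ℓ i ∈ cube u) ≤ 2 := by
    simp only [hiff]
    exact hc.plaquette_card _ _
  obtain ⟨p, q, hpq, hp, hq⟩ := hnb i
  obtain ⟨c₁, hi₁, hp₁⟩ := hc.consecutive i p hp
  obtain ⟨c₂, hi₂, hq₂⟩ := hc.consecutive i q hq
  have hik := ((mem_plane_iff _ _ _).1 (hplane i)).1
  obtain ⟨m, hmd, hmk⟩ := exists_third (ℓ i).2 k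
  have hm := direction_cases hik hmd hmk
  have hext : ∀ v v', ℓ i ∈ cube v → ℓ i ∈ cube v' → v m = v' m →
      Function.update v k h = Function.update v' k h := by
    intro v v' hv hv' hvv
    have h1 := (mem_cube_iff _ _).1 hv (ℓ i).2
    have h2 := (mem_cube_iff _ _).1 hv' (ℓ i).2
    simp only [Near, ne_eq, not_true_eq_false, false_and, or_false] at h1 h2
    ext x
    rcases hm x with rfl | rfl | rfl
    · simp [hik, h1, h2]
    · simp
    · simp [hmk, hvv]
  have hnear : ∀ v, ℓ i ∈ cube v → v m = (ℓ i).1 m ∨ v m = (ℓ i).1 m - 1 := fun v hv =>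
    ((mem_cube_iff _ _).1 hv m).imp id And.right
  have hge : 1 < #(univ.filter fun i => ℓ i ∈ cube u) := by
    rw [Finset.one_lt_card]
    refine ⟨i, by simpa using hi, ?_⟩
    by_cases e₁ : u m = c₁ m
    · refine ⟨p, ?_, hp.ne⟩
      rw [mem_filter, hiff, hext _ _ hi hi₁ e₁]
      exact ⟨mem_univ _, hproj _ _ hp₁⟩
    by_cases e₂ : u m = c₂ m
    · refine ⟨q, ?_, hq.ne⟩
      rw [mem_filter, hiff, hext _ _ hi hi₂ e₂]
      exact ⟨mem_univ _, hproj _ _ hq₂⟩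
    -- The coordinate `m` takes only two values on cubes around the link, so if both neighbours miss
    -- the plaquette of `u` they share the other one.
    have e₃ : c₁ m = c₂ m := by
      have h1 := hnear u hi
      have h2 := hnear _ hi₁
      have h3 := hnear _ hi₂
      grind
    refine (hc.false_of_plaquette hp.ne hq.ne hpq (hproj _ _ hi₁) (hproj _ _ hp₁) ?_).elim
    rw [hext _ _ hi₁ hi₂ e₃]
    exact hproj _ _ hq₂
  rw [show #(univ.filter fun i => ℓ i ∈ cube u) = 2 by omega]
  exact even_two

end IsDualCurve

/-! ### Products of cubes supported on a dual string -/

/-- The dual loop through a link of `A` normal to the plane meets `A` only in that link, so its even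
parity makes the codeword vanish there. -/
theorem eq_zero_of_planar (hL : 3 ≤ L) {A : Finset (Link L)} (hA : IsPlanar A) {c : Config L}
    (hc : c ∈ cubeCode L) (hcA : ∀ l, l ∉ A → c l = 0) : c = 0 := by
  obtain ⟨k, h, hA⟩ := hA
  ext l
  by_cases hl : l ∈ A
  · obtain ⟨h1, h2⟩ := (mem_plane_iff _ _ _).1 (hA hl)
    have hsum := ((mem_cubeCode_iff hL c).1 hc).2 l.1 k l.2 h1
    rw [Pi.zero_apply, ← hsum]
    symm
    refine Finset.sum_eq_single l (fun l' hl' hne => hcA l' fun hA' => hne ?_) fun h => ?_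
    · simp only [dualLoop, mem_filter, mem_univ, true_and] at hl'
      refine Prod.ext ?_ hl'.1
      ext j
      by_cases hj : j = k
      · subst hj
        rw [h2, ((mem_plane_iff _ _ _).1 (hA hA')).2]
      · exact hl'.2 j hj
    · exact absurd (by simp [dualLoop]) h
  · exact hcA l hl

theorem line_subset_of_diff_eq_zero {c : Config L}
    (hc : ∀ v d, diff d (fun w => c (w, d)) v = 0) {l : Link L} (hl : c l ≠ 0) :
    ∀ l' ∈ line l.1 l.2, c l' ≠ 0 := by
  obtain ⟨v, d⟩ := l
  have hstep : ∀ v, c (v - Pi.single d 1, d) = c (v, d) := fun v =>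
    (CharTwo.add_eq_zero.1 (hc v d)).symm
  have hmul : ∀ (n : ℕ), c (v - Pi.single d (n : ZMod L), d) = c (v, d) := by
    intro n
    induction n with
    | zero => simp
    | succ n ih =>
      have h := hstep (v - Pi.single d (n : ZMod L))
      rw [sub_sub, ← Pi.single_add] at h
      rw [← ih, ← h, Nat.cast_succ]
  rintro ⟨w, e⟩ hw
  simp only [line, mem_filter, mem_univ, true_and] at hw
  obtain ⟨rfl, hw⟩ := hw
  have : w = v - Pi.single e (((v e - w e).val : ℕ) : ZMod L) := by
    ext j
    by_cases hj : j = e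
    · subst hj; simp
    · simp [hj, hw j hj]
  rw [this, hmul]
  exact hl

/-- `α d` selects one of the two links at `v` in direction `d`: 0 the outgoing one, 1 the incoming
one. Two selected links span a plaquette with corner `v`. -/
theorem corner_mem_plaquette (v : Vertex L) {α : Fin 3 → ZMod L} (hα : ∀ d, α d = 0 ∨ α d = 1)
    {d e k : Fin 3} (hde : d ≠ e) (hkd : k ≠ d) (hke : k ≠ e) :
    ((v - Pi.single d (α d), d) : Link L)
      ∈ plaquette (v - Pi.single d (α d) - Pi.single e (α e)) k := by
  rw [mem_plaquette_iff, mem_cube_iff]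
  refine ⟨fun m => ?_, hkd.symm, by simp [hke]⟩
  rcases direction_cases hde hkd hke m with rfl | rfl | rfl
  · exact Or.inl (by simp [hde])
  · rcases hα m with h | h
    · exact Or.inl (by simp [h])
    · exact Or.inr ⟨hde.symm, by simp [h]⟩
  · exact Or.inl (by simp [hke])

namespace IsDualCurve

variable {n : ℕ} {H : SimpleGraph (Fin n)} {ℓ : Fin n → Link L}

theorem eq_zero_of_no_line (hL : 3 ≤ L) (hcurve : IsDualCurve H ℓ) (hdeg : DegreeLeTwo H)
    (hconn : H.Preconnected) (hline : ∀ v d, ¬ line v d ⊆ univ.image ℓ) {c : Config L}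
    (hc : c ∈ cubeCode L) (hcA : ∀ l, l ∉ univ.image ℓ → c l = 0) : c = 0 := by
  have himage : ∀ l, c l ≠ 0 → l ∈ univ.image ℓ := fun l hl => by_contra fun h => hl (hcA l h)
  have hstar := ((mem_cubeCode_iff hL c).1 hc).1
  have hdiff : ∀ v d, diff d (fun w => c (w, d)) v = 0 := by
    intro v d
    by_contra hd
    -- By the star relations a nonzero difference in one direction at `v` is nonzero in all three,
    -- so some link of the support ends at `v` in each direction.
    have hcorner : ∀ e, ∃ x : ZMod L, (x = 0 ∨ x = 1) ∧ c (v - Pi.single e x, e) ≠ 0 := by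
      intro e
      rw [diff_eq_of_sum_vertexStar hL (hstar v) d e, diff_apply] at hd
      by_cases h : c (v, e) = 0
      · exact ⟨1, Or.inr rfl, by simpa [h] using hd⟩
      · exact ⟨0, Or.inl rfl, by simpa using h⟩
    choose α hα hcα using hcorner
    have hidx : ∀ e, ∃ i, ℓ i = (v - Pi.single e (α e), e) := fun e => by
      simpa using himage _ (hcα e)
    choose i hi using hidx
    have hinj : ∀ e e', e ≠ e' → i e ≠ i e' := by
      intro e e' hne h
      have h' := congrArg (fun x => (ℓ x).2) h
      simp only [hi] at h'
      exact hne h'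
    have hadj : ∀ e e', e ≠ e' → H.Adj (i e) (i e') := by
      intro e e' hne
      obtain ⟨k, hk, hk'⟩ := exists_third e e'
      refine hcurve.plaquette_adj (v - Pi.single e (α e) - Pi.single e' (α e')) k _ _
        (hinj _ _ hne) ?_ ?_
      · rw [hi]
        exact corner_mem_plaquette v hα hne hk hk'
      · rw [hi, sub_right_comm]
        exact corner_mem_plaquette v hα hne.symm hk' hk
    -- The three corner links are pairwise adjacent, so with degree at most two they form a whole
    -- component, and the string is connected.
    have hall : ∀ j, j ∈ Set.range i := by
      refine mem_of_preconnected hconn ?_ ⟨0, rfl⟩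
      rintro _ ⟨e, rfl⟩ b hb
      obtain ⟨j, k, hj, hk, hjk, -⟩ := exists_others e
      rcases hdeg.eq_or_eq (hadj e j hj) (hadj e k hk) (hinj j k hjk) hb with rfl | rfl
      · exact ⟨j, rfl⟩
      · exact ⟨k, rfl⟩
    have honly : ∀ w e, c (w, e) ≠ 0 → w = v - Pi.single e (α e) := by
      intro w e h
      obtain ⟨j, -, hj⟩ := Finset.mem_image.1 (himage _ h)
      obtain ⟨e', rfl⟩ := hall j
      rw [hi, Prod.mk.injEq] at hj
      obtain ⟨hj, rfl⟩ := hj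
      exact hj.symm
    have h1 := one_ne_zero_zmod hL
    -- Off the plane through `v` normal to direction 0 there is no support in direction 1, so the
    -- star relation kills the difference in direction 0. At the far end of the selected link in
    -- direction 0 this difference is nonetheless 1.
    have hside : ∀ v' : Vertex L, v' 0 ≠ v 0 → diff 0 (fun w => c (w, 0)) v' = 0 := by
      intro v' hv'
      rw [diff_eq_of_sum_vertexStar hL (hstar v') 0 1, diff_apply]
      have hz : ∀ w : Vertex L, w 0 ≠ v 0 → c (w, 1) = 0 := by
        intro w hw
        by_contra h
        exact hw (by rw [honly w 1 h]; simp)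
      rw [hz _ hv', hz _ (by simpa using hv'), add_zero]
    have hzero : ∀ w : Vertex L, w 0 ≠ v 0 - α 0 → c (w, 0) = 0 := by
      intro w hw
      by_contra h
      exact hw (by rw [honly w 0 h]; simp)
    have hc0 := hcα 0
    rcases hα 0 with h | h
    · have hs := hside (v + Pi.single 0 1) (by simpa using h1)
      rw [diff_apply, add_sub_cancel_right, hzero _ (by simpa [h] using h1), zero_add] at hs
      rw [h, Pi.single_zero, sub_zero] at hc0
      exact hc0 hs
    · have hs := hside (v - Pi.single 0 1) (by simpa using h1)
      rw [diff_apply, hzero (v - Pi.single 0 1 - Pi.single 0 1) (by simpa [h] using h1),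
        add_zero] at hs
      rw [h] at hc0
      exact hc0 hs
  by_contra hne
  obtain ⟨l, hl⟩ := Function.ne_iff.1 hne
  exact hline l.1 l.2 fun l' hl' => himage l' (line_subset_of_diff_eq_zero hdiff hl l' hl')

end IsDualCurve

/-! ### Paths and cycles -/

theorem degreeLeTwo_pathGraph (n : ℕ) : DegreeLeTwo (SimpleGraph.pathGraph n) := by
  -- At the ends of the path the truncated `i - 1` and the default `i` both equal `i`, which is
  -- never its own neighbour.
  refine fun i => ⟨⟨i.val - 1, by omega⟩, if h : i.val + 1 < n then ⟨i.val + 1, h⟩ else i,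
    fun j hj => ?_⟩
  rcases SimpleGraph.pathGraph_adj.1 hj with h | h
  · right
    rw [dif_pos (by omega)]
    exact Fin.ext h.symm
  · left
    exact Fin.ext (by simp only; omega)

theorem pathGraph_endpoint {n : ℕ} (hn : 1 ≤ n) :
    ¬ ∀ i, ∃ p q, p ≠ q ∧ (SimpleGraph.pathGraph n).Adj i p ∧ (SimpleGraph.pathGraph n).Adj i q := by
  intro h
  obtain ⟨p, q, hpq, hp, hq⟩ := h ⟨0, hn⟩
  rw [SimpleGraph.pathGraph_adj] at hp hq
  apply hpq
  ext
  simp only at hp hq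
  omega

theorem degreeLeTwo_cycleGraph {n : ℕ} (hn : 3 ≤ n) : DegreeLeTwo (SimpleGraph.cycleGraph n) := by
  obtain ⟨m, rfl⟩ : ∃ m, n = m + 2 := ⟨n - 2, by omega⟩
  refine fun i => ⟨i - 1, i + 1, fun j hj => ?_⟩
  rcases SimpleGraph.cycleGraph_adj.1 hj with h | h
  · left; rw [← h]; abel
  · right; rw [← h]; abel

theorem cycleGraph_neighbors {n : ℕ} (hn : 3 ≤ n) (i : Fin n) :
    ∃ p q, p ≠ q ∧ (SimpleGraph.cycleGraph n).Adj i p ∧ (SimpleGraph.cycleGraph n).Adj i q := by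
  obtain ⟨m, rfl⟩ : ∃ m, n = m + 3 := ⟨n - 3, by omega⟩
  refine ⟨i - 1, i + 1, ?_, ?_, ?_⟩
  · intro h
    have h2 : (1 : Fin (m + 3)) + 1 = 0 := by
      have : i - 1 + 1 = i + 1 + 1 := by rw [h]
      rw [sub_add_cancel, add_assoc, left_eq_add] at this
      exact this
    have h3 := congrArg Fin.val h2
    rw [Fin.val_add, Fin.val_one, Nat.mod_eq_of_lt (by omega)] at h3
    exact absurd h3 (by simp)
  · exact SimpleGraph.cycleGraph_adj.2 (Or.inl (by abel))
  · exact SimpleGraph.cycleGraph_adj.2 (Or.inr (by abel))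

theorem IsOpenDualString.eq_zero (hL : 3 ≤ L) {A : Finset (Link L)} (hA : IsOpenDualString A)
    {w : Config L} (hw : ∀ l, l ∉ A → w l = 0) (hcube : ∀ u, ∑ l ∈ cube u, w l = 0) : w = 0 := by
  obtain ⟨n, ℓ, hn, hc, rfl⟩ := hA
  by_contra hne
  exact pathGraph_endpoint hn (hc.eq_ind_of_ne_zero hL (degreeLeTwo_pathGraph n)
    (SimpleGraph.pathGraph_preconnected n) hw hcube hne).2.1

theorem IsClosedDualString.eq_ind_and_planar (hL : 3 ≤ L) {A : Finset (Link L)}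
    (hA : IsClosedDualString A) {w : Config L} (hw : ∀ l, l ∉ A → w l = 0)
    (hcube : ∀ u, ∑ l ∈ cube u, w l = 0) (hne : w ≠ 0) : w = ind A ∧ IsPlanar A := by
  obtain ⟨n, ℓ, hn, hc, rfl⟩ := hA
  have h := hc.eq_ind_of_ne_zero hL (degreeLeTwo_cycleGraph hn)
    SimpleGraph.cycleGraph_preconnected hw hcube hne
  exact ⟨h.1, h.2.2⟩

theorem IsClosedDualString.sum_cube_ind {A : Finset (Link L)} (hA : IsClosedDualString A)
    (hplanar : IsPlanar A) (u : Vertex L) : ∑ l ∈ cube u, ind A l = 0 := by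
  obtain ⟨n, ℓ, hn, hc, rfl⟩ := hA
  obtain ⟨k, h, hplane⟩ := hplanar
  exact hc.sum_cube_ind (cycleGraph_neighbors hn)
    (fun i => hplane (Finset.mem_image_of_mem _ (mem_univ i))) u

theorem IsDualString.eq_zero_of_mem_cubeCode (hL : 3 ≤ L) {A : Finset (Link L)}
    (hA : IsDualString A) (hA' : IsPlanar A ∨ ∀ v d, ¬ line v d ⊆ A) {c : Config L}
    (hc : c ∈ cubeCode L) (hcA : ∀ l, l ∉ A → c l = 0) : c = 0 := by
  rcases hA' with hplanar | hline
  · exact eq_zero_of_planar hL hplanar hc hcA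
  · rcases hA with ⟨n, ℓ, hn, hcurve, rfl⟩ | ⟨n, ℓ, hn, hcurve, rfl⟩
    · exact hcurve.eq_zero_of_no_line hL (degreeLeTwo_pathGraph n)
        (SimpleGraph.pathGraph_preconnected n) hline hc hcA
    · exact hcurve.eq_zero_of_no_line hL (degreeLeTwo_cycleGraph hn)
        SimpleGraph.cycleGraph_preconnected hline hc hcA

theorem IsClosedDualString.nonempty {A : Finset (Link L)} (hA : IsClosedDualString A) :
    A.Nonempty := by
  obtain ⟨n, ℓ, hn, -, rfl⟩ := hA
  exact ⟨ℓ ⟨0, by omega⟩, Finset.mem_image_of_mem _ (mem_univ _)⟩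

end XCube

/-! ### Assembly of the four claims -/

theorem mainTheorem4 (L : ℕ) [NeZero L] (hL : 3 ≤ L) :
    (∃ ψ : XCube.State L, XCube.IsXCubeState ψ ∧
      ∀ φ : XCube.State L, XCube.IsXCubeState φ → ∃ z : ℂ, ‖z‖ = 1 ∧ φ = z • ψ) ∧
    (∀ ψ : XCube.State L, XCube.IsXCubeState ψ →
      ∀ A : Finset (XCube.Link L), XCube.IsDualString A →
        (XCube.IsPlanar A ∨ ∀ v d, ¬ XCube.line v d ⊆ A) →
        (XCube.IsClosedDualString A ∧ XCube.IsPlanar A → XCube.zeta ψ A = -1) ∧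
        (¬ (XCube.IsClosedDualString A ∧ XCube.IsPlanar A) → XCube.zeta ψ A = 0)) ∧
    (∀ F : Finset (XCube.Vertex L × Fin 3), ∀ v d,
      Even (XCube.supportB F ∩ XCube.line v d).card) ∧
    (∀ A : Finset (XCube.Link L), XCube.IsClosedDualString A → ¬ XCube.IsPlanar A →
      ∀ F : Finset (XCube.Vertex L × Fin 3),
        XCube.supportB F ⊆ A → XCube.supportB F = ∅) := by
  refine ⟨?_, ?_, ?_, ?_⟩
  · obtain ⟨ψ, hψ⟩ := XCube.exists_isXCubeState L hL
    exact ⟨ψ, hψ, fun φ hφ => hψ.exists_eq_smul hL hφ⟩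
  · intro ψ hψ A hA hA'
    have hcode := fun c hc hcA => hA.eq_zero_of_mem_cubeCode hL hA' (c := c) hc hcA
    constructor
    · rintro ⟨hclosed, hplanar⟩
      refine XCube.zeta_eq_neg_one hL hψ hclosed.nonempty hcode (hclosed.sum_cube_ind hplanar)
        fun w hw hcube => ?_
      by_cases h : w = 0
      · exact Or.inl h
      · exact Or.inr (hclosed.eq_ind_and_planar hL hw hcube h).1
    · intro hnot
      refine XCube.zeta_eq_zero hL hψ hcode fun w hw hcube => ?_
      rcases hA with hopen | hclosed
      · exact hopen.eq_zero hL hw hcube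
      · by_contra h
        exact hnot ⟨hclosed, (hclosed.eq_ind_and_planar hL hw hcube h).2⟩
  · intro F v d
    rw [Finset.inter_comm, XCube.even_card_inter_iff, XCube.sum_line_supportB hL]
  · intro A hclosed hnot F hF
    by_contra hne
    have hw : ∀ l, l ∉ A → XCube.ind (XCube.supportB F) l = 0 := fun l hl =>
      if_neg fun h => hl (hF h)
    -- The support of a product of `B_v^k` is even on cubes, so a nonempty one inside `A` would
    -- force `A` to be planar.
    refine hnot (hclosed.eq_ind_and_planar hL hw (XCube.sum_cube_supportB hL F) fun h => hne ?_).2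
    refine Finset.eq_empty_of_forall_notMem fun l hl => ?_
    have h' := congrFun h l
    rw [XCube.ind, if_pos hl] at h'
    exact one_ne_zero h'
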